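/- Let $k$ be a non-archimedean local field with ring of integers $\mathfrak o$, residue field of $q$ elements, normalized absolute value $|\cdot|$ (a uniformizer has absolute value $q^{-1}$), and $|2|=1$. Let $n\ge 0$ and let $B$ be a quadratic form on $k^n$ whose symmetric Gram matrix has entries in $\mathfrak o$ and unit determinant. Let $$k^{n+3}=k\,x'\oplus k^n\oplus k\,x\oplus k\,e_-$$ carry the quadratic form given by $B$ on $k^n$, by $\langle x',x\rangle=1$, $\langle x,x\rangle=\langle x',x'\rangle=0$, and $\langle e_-,e_-\rangle=-1$, the three summands $kx'\oplus kx$, $k^n$, $ke_-$ being mutually orthogonal. Put $e_+=x'+\tfrac12x$ and $e=e_++e_-$. Let $G=\mathrm O(n+3)$ be the isometry group of this form, acting on row vectors from the right, let $H=\mathrm O(n+2)\subset G$ be the fixer of $e_-$, and let $\varTheta=\mathrm O(n+1)$ be the fixer of both $e_+$ and $e_-$. Let $da$ be the additive Haar measure on $k$ (and its $n$-fold product on $k^n$) with $\operatorname{vol}(\mathfrak o)=1$, and let $dt,\,d\lambda$ denote the multiplicative Haar measure on $k^\times$ with $\operatorname{vol}(\mathfrak o^\times)=1$. Let $\Phi$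 be the characteristic function of $\mathfrak o^{n+3}$ (in the coordinates above) and, for $s\in\mathbb C$ and $\alpha=(n+1)s$, let $$\varphi(g)=\int_{k^\times}|t|^\alpha\,\Phi(te\cdot g)\,dt\qquad(g\in G),$$ a function on $G$ that is left invariant under $\varTheta$. For $\lambda\in k^\times$ and $a\in k^n$ let $m_\lambda\in H$ be given by $x'\mapsto\lambda x'$, $x\mapsto\lambda^{-1}x$ and the identity on $k^n$, and let $n_a\in H$ be given by $x'\mapsto x'+a-\tfrac12B(a)x$, $v\mapsto v-\langle v,a\rangle x$ for $v\in k^n$, and $x\mapsto x$. There is exactly one right $H$-invariant Radon measure on $\varTheta\backslash H$ for which the set of cosets $\varTheta m_\lambda n_a$ with $\lambda\in\mathfrak o^\times$, $a\in\mathfrak o^n$ has volume $1$; equip $\varTheta\backslash H$ with it. Finally, for $\alpha,\beta\in\mathbb C$ let $$\Pi^B(\alpha,\beta)=\int_{k^\times\cap\mathfrak o}|t|^\alpha\int_{\mathfrak o^n}\int_{k^\times}|\lambda|^\beta\cdot\mathrm{ch}\bigl\{\lambda:|t^2-B(a)|\le|\lambda|\le1\bigr\}\,d\lambda\,da\,dt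 .$$ Proposition. Let $\operatorname{Re}\alpha=\operatorname{Re}\bigl((n+1)s\bigr)>n$. Then the integral defining $\varphi(g)$ converges absolutely for all $g\in G$, the function $\varphi$ is integrable on $\varTheta\backslash H$, the integral defining $\Pi^B(\alpha-n,0)$ converges absolutely as a triple integral, and the unnormalized local period is $$\int_{\varTheta\backslash H}\varphi=\Pi^B(\alpha-n,0)=\Pi^B\bigl((n+1)(s-1)+1,\,0\bigr).$$ -/

import Mathlib

open MeasureTheory Matrix

noncomputable section

namespace LocalPeriod

/-- Coordinates on `k^{n+3} = k^n ⊕ k x' ⊕ k x ⊕ k e₋`: `Sum.inl i` is the `i`-th coordinate on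
`k^n`, and `Sum.inr 0`, `Sum.inr 1`, `Sum.inr 2` are the coordinates along `x'`, `x`, `e₋`.
Vectors are row vectors and groups act on the right. -/
abbrev Idx (n : ℕ) : Type := Fin n ⊕ Fin 3

section Algebra

variable {K : Type*} [Field K] {n : ℕ}

/-- The quadratic form `B(a) = a B aᵗ` on `k^n` with Gram matrix `B`. -/
def quad (B : Matrix (Fin n) (Fin n) K) (a : Fin n → K) : K := a ⬝ᵥ (B *ᵥ a)

/-- The Gram matrix of the form on `k^{n+3}`: `B` on `k^n`, `⟨x', x⟩ = 1`, `⟨x, x⟩ = ⟨x', x'⟩ = 0`,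
`⟨e₋, e₋⟩ = -1`, all other pairings between the summands being zero. -/
def gram (B : Matrix (Fin n) (Fin n) K) : Matrix (Idx n) (Idx n) K :=
  Matrix.fromBlocks B 0 0 !![0, 1, 0; 1, 0, 0; 0, 0, -1]

/-- The vector `e₊ = x₊ = x' + x / 2`, with `⟨e₊, e₊⟩ = 1`. -/
def ePlus : Idx n → K := Sum.elim 0 ![1, 2⁻¹, 0]

/-- The vector `e₋`. -/
def eMinus : Idx n → K := Sum.elim 0 ![0, 0, 1]

/-- The isotropic vector `e = e₊ + e₋`. -/
def eVec : Idx n → K := ePlus + eMinus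

/-- `G = O(n+3)`, the isometry group of the form on `k^{n+3}`. -/
def groupG (B : Matrix (Fin n) (Fin n) K) : Subgroup (GL (Idx n) K) where
  carrier := {g | (g : Matrix (Idx n) (Idx n) K) * gram B * (g : Matrix (Idx n) (Idx n) K)ᵀ
    = gram B}
  one_mem' := by simp
  mul_mem' := by
    intro g h hg hh
    simp only [Set.mem_ofPred_eq] at hg hh ⊢
    rw [Units.val_mul, Matrix.transpose_mul]
    calc (g : Matrix (Idx n) (Idx n) K) * h * gram B * ((h : Matrix (Idx n) (Idx n) K)ᵀ
          * (g : Matrix (Idx n) (Idx n) K)ᵀ)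
        = g * (h * gram B * (h : Matrix (Idx n) (Idx n) K)ᵀ)
          * (g : Matrix (Idx n) (Idx n) K)ᵀ := by simp only [Matrix.mul_assoc]
      _ = gram B := by rw [hh, hg]
  inv_mem' := by
    intro g hg
    simp only [Set.mem_ofPred_eq] at hg ⊢
    have h1 : ((g⁻¹ : GL (Idx n) K) : Matrix (Idx n) (Idx n) K) * g = 1 := g.inv_mul
    have h2 : (g : Matrix (Idx n) (Idx n) K)ᵀ
        * ((g⁻¹ : GL (Idx n) K) : Matrix (Idx n) (Idx n) K)ᵀ = 1 := by
      rw [← Matrix.transpose_mul, h1, Matrix.transpose_one]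
    calc ((g⁻¹ : GL (Idx n) K) : Matrix (Idx n) (Idx n) K) * gram B
          * ((g⁻¹ : GL (Idx n) K) : Matrix (Idx n) (Idx n) K)ᵀ
        = (g⁻¹ : GL (Idx n) K) * (g * gram B * (g : Matrix (Idx n) (Idx n) K)ᵀ)
          * ((g⁻¹ : GL (Idx n) K) : Matrix (Idx n) (Idx n) K)ᵀ := by rw [hg]
      _ = (((g⁻¹ : GL (Idx n) K) : Matrix (Idx n) (Idx n) K) * g) * gram B
          * ((g : Matrix (Idx n) (Idx n) K)ᵀ
            * ((g⁻¹ : GL (Idx n) K) : Matrix (Idx n) (Idx n) K)ᵀ) := by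
          simp only [Matrix.mul_assoc]
      _ = gram B := by rw [h1, h2, Matrix.one_mul, Matrix.mul_one]

/-- The right action of `G` on row vectors. -/
def act {B : Matrix (Fin n) (Fin n) K} (v : Idx n → K) (g : groupG B) : Idx n → K :=
  v ᵥ* ((g : GL (Idx n) K) : Matrix (Idx n) (Idx n) K)

theorem act_one {B : Matrix (Fin n) (Fin n) K} (v : Idx n → K) :
    act v (1 : groupG B) = v := by
  simp [act]

theorem act_mul {B : Matrix (Fin n) (Fin n) K} (v : Idx n → K) (g h : groupG B) :
    act v (g * h) = act (act v g) h := by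
  simp [act, Matrix.vecMul_vecMul]

/-- The subgroup of `G` fixing a vector. -/
def fixer (B : Matrix (Fin n) (Fin n) K) (v : Idx n → K) : Subgroup (groupG B) where
  carrier := {g | act v g = v}
  one_mem' := act_one v
  mul_mem' := by
    intro g h hg hh
    simp only [Set.mem_ofPred_eq] at hg hh ⊢
    rw [act_mul, hg, hh]
  inv_mem' := by
    intro g hg
    simp only [Set.mem_ofPred_eq] at hg ⊢
    conv_lhs => rw [← hg]
    rw [← act_mul, mul_inv_cancel, act_one]

/-- `H = O(n+2)`, the subgroup of `G` fixing `e₋`. -/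
def groupH (B : Matrix (Fin n) (Fin n) K) : Subgroup (groupG B) := fixer B eMinus

/-- `Θ = O(n+1)`, the subgroup of `H` fixing `e₊`. -/
def groupTheta (B : Matrix (Fin n) (Fin n) K) : Subgroup (groupH B) :=
  (fixer B ePlus).subgroupOf (groupH B)

theorem act_eVec_theta {B : Matrix (Fin n) (Fin n) K} (θ : groupH B) (hθ : θ ∈ groupTheta B) :
    act eVec (θ : groupG B) = eVec := by
  have h1 : act ePlus (θ : groupG B) = ePlus := hθ
  have h2 : act eMinus (θ : groupG B) = eMinus := θ.2
  unfold eVec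
  conv_rhs => rw [← h1, ← h2]
  simp [act, Matrix.add_vecMul]

/-- The space `Θ\H` of right cosets `Θh`. -/
def ThetaH (B : Matrix (Fin n) (Fin n) K) : Type _ :=
  Quotient (QuotientGroup.rightRel (groupTheta B))

/-- The coset `Θh`. -/
def ThetaH.mk {B : Matrix (Fin n) (Fin n) K} (h : groupH B) : ThetaH B :=
  Quotient.mk (QuotientGroup.rightRel (groupTheta B)) h

/-- The right action of `H` on `Θ\H`: `Θx ↦ Θxh`. -/
def ThetaH.rmul {B : Matrix (Fin n) (Fin n) K} (h : groupH B) : ThetaH B → ThetaH B :=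
  Quotient.lift (fun x => ThetaH.mk (x * h)) (by
    intro x y hxy
    have hxy' : y * x⁻¹ ∈ groupTheta B := QuotientGroup.rightRel_apply.mp hxy
    refine Quotient.sound ?_
    change QuotientGroup.rightRel (groupTheta B) _ _
    rw [QuotientGroup.rightRel_apply]
    simpa [mul_assoc] using hxy')

/-- The matrix `m_λ`: `x' ↦ λ x'`, `x ↦ λ⁻¹ x`, identity on `k^n` and on `e₋`. -/
def mMat (n : ℕ) (l : Kˣ) : Matrix (Idx n) (Idx n) K :=
  Matrix.diagonal (Sum.elim 1 ![(l : K), (l : K)⁻¹, 1])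

/-- The matrix `n_a`: `x' ↦ x' + a - (B(a)/2) x`, `v ↦ v - ⟨v, a⟩ x` for `v ∈ k^n`, `x ↦ x`,
`e₋ ↦ e₋` (on row vectors). -/
def nMat (B : Matrix (Fin n) (Fin n) K) (a : Fin n → K) : Matrix (Idx n) (Idx n) K :=
  Matrix.fromBlocks 1 (Matrix.of fun i => ![0, -(B *ᵥ a) i, 0]) (Matrix.of ![a, 0, 0])
    !![1, -(2⁻¹ * quad B a), 0; 0, 1, 0; 0, 0, 1]

end Algebra

section Analysis

variable {K : Type*} [NontriviallyNormedField K] {n : ℕ}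

instance (B : Matrix (Fin n) (Fin n) K) : TopologicalSpace (ThetaH B) :=
  inferInstanceAs (TopologicalSpace (Quotient (QuotientGroup.rightRel (groupTheta B))))

instance (B : Matrix (Fin n) (Fin n) K) : MeasurableSpace (ThetaH B) := borel _

instance (B : Matrix (Fin n) (Fin n) K) : BorelSpace (ThetaH B) := ⟨rfl⟩

/-- The set of cosets `Θ m_λ n_a` with `λ ∈ 𝔬^×` and `a ∈ 𝔬^n`. -/
def unitCell (B : Matrix (Fin n) (Fin n) K) : Set (ThetaH B) :=
  {c | ∃ (h : groupH B) (l : Kˣ) (a : Fin n → K), ‖(l : K)‖ = 1 ∧ (∀ i, ‖a i‖ ≤ 1) ∧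
    (((h : groupG B) : GL (Idx n) K) : Matrix (Idx n) (Idx n) K) = mMat n l * nMat B a ∧
    c = ThetaH.mk h}

/-- `μ` is the right `H`-invariant Radon measure on `Θ\H` under which the cosets `Θ m_λ n_a` with
`λ ∈ 𝔬^×`, `a ∈ 𝔬^n` have total mass one. -/
structure IsPeriodMeasure (B : Matrix (Fin n) (Fin n) K) (μ : Measure (ThetaH B)) : Prop where
  finiteOnCompacts : IsFiniteMeasureOnCompacts μ
  invariant : ∀ (h : groupH B) (S : Set (ThetaH B)), MeasurableSet S →
    μ (ThetaH.rmul h ⁻¹' S) = μ S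
  normalized : μ (unitCell B) = 1

/-- `Φ`, the characteristic function of `𝔬^{n+3}`. -/
def PhiFun (v : Idx n → K) : ℂ := Set.indicator {v : Idx n → K | ∀ i, ‖v i‖ ≤ 1} (fun _ => 1) v

variable [MeasurableSpace K]

/-- The spherical function `φ(g) = ∫_{k^×} |t|^α Φ(t e·g) d^×t` on `G`. -/
def phi (dt : Measure Kˣ) (B : Matrix (Fin n) (Fin n) K) (α : ℂ) (g : groupG B) : ℂ :=
  ∫ t : Kˣ, ((‖(t : K)‖ : ℝ) : ℂ) ^ α * PhiFun ((t : K) • act eVec g) ∂dt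

theorem phi_theta_mul (dt : Measure Kˣ) (B : Matrix (Fin n) (Fin n) K) (α : ℂ)
    (θ : groupH B) (hθ : θ ∈ groupTheta B) (g : groupG B) :
    phi dt B α ((θ : groupG B) * g) = phi dt B α g := by
  simp only [phi, act_mul, act_eVec_theta θ hθ]

/-- The restriction of `φ` to `H`, as a function on `Θ\H`. -/
def phiQuot (dt : Measure Kˣ) (B : Matrix (Fin n) (Fin n) K) (α : ℂ) : ThetaH B → ℂ :=
  Quotient.lift (fun h : groupH B => phi dt B α (h : groupG B)) (by
    intro x y hxy
    have hxy' : y * x⁻¹ ∈ groupTheta B := QuotientGroup.rightRel_apply.mp hxy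
    have h := phi_theta_mul dt B α (y * x⁻¹) hxy' (x : groupG B)
    change phi dt B α (x : groupG B) = phi dt B α (y : groupG B)
    rw [← h]
    simp)

/-- The characteristic function of `{λ : |t² - B(a)| ≤ |λ| ≤ 1}`. -/
def chFun (B : Matrix (Fin n) (Fin n) K) (t : Kˣ) (a : Fin n → K) (l : Kˣ) : ℂ :=
  Set.indicator {l : Kˣ | ‖(t : K) ^ 2 - quad B a‖ ≤ ‖(l : K)‖ ∧ ‖(l : K)‖ ≤ 1} (fun _ => 1) l

/-- `Π^B(α, β)`, the iterated integral over `t ∈ k^× ∩ 𝔬`, `a ∈ 𝔬^n`, `λ ∈ k^×`. -/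
def PiFun (da : Measure K) (dt : Measure Kˣ) (B : Matrix (Fin n) (Fin n) K) (α β : ℂ) : ℂ :=
  ∫ t in {t : Kˣ | ‖(t : K)‖ ≤ 1}, ((‖(t : K)‖ : ℝ) : ℂ) ^ α *
    ∫ a in {a : Fin n → K | ∀ i, ‖a i‖ ≤ 1},
      ∫ l : Kˣ, ((‖(l : K)‖ : ℝ) : ℂ) ^ β * chFun B t a l ∂dt
    ∂(Measure.pi fun _ => da) ∂dt

/-- Absolute convergence of the triple integral defining `Π^B(α, β)`. -/
def PiConverges (da : Measure K) (dt : Measure Kˣ) (B : Matrix (Fin n) (Fin n) K) (α β : ℂ) :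
    Prop :=
  IntegrableOn
    (fun p : Kˣ × (Fin n → K) × Kˣ =>
      ((‖(p.1 : K)‖ : ℝ) : ℂ) ^ α *
        (((‖(p.2.2 : K)‖ : ℝ) : ℂ) ^ β * chFun B p.1 p.2.1 p.2.2))
    {p | ‖(p.1 : K)‖ ≤ 1 ∧ ∀ i, ‖p.2.1 i‖ ≤ 1}
    (dt.prod ((Measure.pi fun _ => da).prod dt))

end Analysis

end LocalPeriod

end

set_option linter.unusedSectionVars false

/-! Since $\varTheta$ is the stabilizer of $e_+$ in $H$, the map $\varTheta h\mapsto e_+h$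
identifies $\varTheta\backslash H$ with the quadric of vectors of norm $1$ in $e_-^\perp$. Where the
$x'$-coordinate is nonzero, a point is $e_+m_\lambda n_a$ for unique $(\lambda,a)$, because the
equation of the quadric determines the $x$-coordinate. Right translation by the group of all
$m_\lambda n_a$ forces an invariant measure on this open cell to be a multiple of
$|\lambda|^n\,d\lambda\,da$ (`eq_smul_cellMeasure`). The rest of the quadric is null: the elements
$n_bw$, with $b$ in a countable dense set, carry it into the part of the cell where the
$x$-coordinate vanishes, and there each $a$ admits at most two $\lambda$. So the period measure is
the image of $|\lambda|^n\,d\lambda\,da$ (`IsPeriodMeasure.eq_map`), which gives uniqueness.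

For existence, additive Haar measure on an $H$-stable neighbourhood of the quadric in $k^{n+3}$ is
pushed forward along $w\mapsto (w-w_-e_-)/\sqrt{q(w)}$, where $w_-$ is the $e_-$-coordinate and $q$
the form on $e_-^\perp$. The square root exists near $1$ because $|2|=1$, the map commutes with $H$,
and $H$ preserves Haar measure since $|\det h|=1$ (`exists_isPeriodMeasure`).

The coordinates of $te\cdot m_\lambda n_a$ are $t\lambda a$, $t\lambda$, $t(\lambda^{-1}-\lambda
B(a))/2$ and $t$. After the substitution $(\lambda,a)\mapsto(t\lambda,t\lambda a)$, their
integrality becomes exactly the domain of $\Pi^B$ (`smul_act_eVec_integral_iff`), while the measure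
acquires the factor $|t|^{-n}$ (`measurePreserving_substMap`). This turns $\alpha$ into $\alpha-n$.

Fubini is justified by absolute convergence of the triple integral (`piConverges`). For $n\ge1$ this
rests on the bound $C|\lambda|^{1/2}$ for the volume of $\{a\in\mathfrak
o^n:|t^2-B(a)|\le|\lambda|\}$; for $n=0$ the condition $|t|^2\le|\lambda|$ takes its place. -/

noncomputable section

namespace LocalPeriod

/-! ### The normalized absolute value as the modulus of additive Haar measure. -/

section Modulus

open scoped Pointwise NNReal ENNReal NormedField

/-- The normalized absolute value is the modulus of the additive group: multiplication by `x`
scales additive Haar measure by `‖x‖`. -/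
def NormIsModulus (K : Type*) [NontriviallyNormedField K] [ProperSpace K] : Prop :=
  ∀ x : Kˣ, distribHaarChar K x = ‖(x : K)‖₊

/-- The ring of integers. -/
abbrev integerRing (K : Type*) [NontriviallyNormedField K] [IsUltrametricDist K] : Subring K :=
  (NormedField.valuation (K := K)).integer

theorem units_smul_closedBall {K : Type*} [NontriviallyNormedField K] (x : Kˣ) (r : ℝ) :
    x • Metric.closedBall (0 : K) r = Metric.closedBall 0 (‖(x : K)‖ * r) := by
  ext y
  rw [Set.mem_smul_set_iff_inv_smul_mem]
  have hx : 0 < ‖(x : K)‖ := norm_pos_iff.mpr x.ne_zero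
  simp [Units.smul_def, inv_mul_le_iff₀ hx]

variable {K : Type*} [NontriviallyNormedField K] [IsUltrametricDist K] [ProperSpace K]

theorem isDiscreteValuationRing_integer :
    IsDiscreteValuationRing (integerRing K) := by
  have : CompactSpace (Valued.v (R := K)).integer := by
    refine isCompact_iff_compactSpace.mp ?_
    convert isCompact_closedBall (0 : K) 1 using 1
    ext x
    simp [Valued.integer.mem_iff]
  have : (Valued.v (R := K)).IsNontrivial := by
    rw [Valuation.isNontrivial_iff_exists_lt_one]
    obtain ⟨x, hx, hx'⟩ := NormedField.exists_norm_lt_one K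
    refine ⟨x, norm_pos_iff.mp hx, ?_⟩
    simpa [← NNReal.coe_lt_coe] using hx'
  exact Valued.integer.isDiscreteValuationRing_of_compactSpace (K := K)

theorem exists_norm_eq_zpow {ϖ : (integerRing K)} (hϖ : Irreducible ϖ)
    (x : Kˣ) : ∃ m : ℤ, ‖(x : K)‖ = ‖(ϖ : K)‖ ^ m := by
  have := isDiscreteValuationRing_integer (K := K)
  have key : ∀ y : K, y ≠ 0 → ‖y‖ ≤ 1 → ∃ m : ℕ, ‖y‖ = ‖(ϖ : K)‖ ^ m := by
    intro y hy0 hy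
    obtain ⟨m, u, hu⟩ := IsDiscreteValuationRing.associated_pow_irreducible
      (x := (⟨y, Valued.integer.mem_iff.mpr hy⟩ : (integerRing K)))
      (by simpa [Subtype.ext_iff] using hy0) hϖ
    refine ⟨m, ?_⟩
    have h := congrArg (fun z : (integerRing K) => ‖(z : K)‖) hu
    have hu1 : ‖((u : (integerRing K)) : K)‖ = 1 :=
      Valued.integer.norm_coe_unit u
    simpa [hu1] using h
  rcases le_total ‖(x : K)‖ 1 with h | h
  · obtain ⟨m, hm⟩ := key x x.ne_zero h
    exact ⟨m, by simpa using hm⟩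
  · obtain ⟨m, hm⟩ := key (x : K)⁻¹ (inv_ne_zero x.ne_zero) (by
      rw [norm_inv]; exact inv_le_one_of_one_le₀ h)
    refine ⟨-m, ?_⟩
    rw [norm_inv] at hm
    simp [← hm]

variable [MeasurableSpace K] [BorelSpace K]

theorem distribHaarChar_eq_of_closedBall (da : Measure K) [da.IsAddHaarMeasure] (x : Kˣ)
    {r : ℝ≥0} (h : da (Metric.closedBall 0 ‖(x : K)‖) = r * da (Metric.closedBall 0 1)) :
    distribHaarChar K x = r := by
  refine distribHaarChar_eq_of_measure_smul_eq_mul (μ := da) (s := Metric.closedBall 0 1) ?_ ?_ ?_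
  · exact (Metric.measure_closedBall_pos _ _ one_pos).ne'
  · exact (isCompact_closedBall _ _).measure_ne_top
  · rw [units_smul_closedBall, mul_one, h]

/-- The ring of integers is the disjoint union of the cosets of its maximal ideal, all of the same
volume, and their number is the order of the residue field. -/
theorem card_residueField_mul_measure (da : Measure K) [da.IsAddHaarMeasure]
    [Finite (IsLocalRing.ResidueField (integerRing K))]
    {ϖ : (integerRing K)} (hϖ : Irreducible ϖ) :
    (Nat.card (IsLocalRing.ResidueField (integerRing K)) : ℝ≥0∞) *
      da (Metric.closedBall 0 ‖(ϖ : K)‖) = da (Metric.closedBall 0 1) := by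
  have := isDiscreteValuationRing_integer (K := K)
  have hOset : ((integerRing K) : Set K) = Metric.closedBall 0 1 := by
    ext x
    rw [SetLike.mem_coe, mem_closedBall_zero_iff]
    exact Valued.integer.mem_iff
  have hOmeas : MeasurableSet ((integerRing K) : Set K) := by
    rw [hOset]; exact Metric.isClosed_closedBall.measurableSet
  let P : AddSubgroup (integerRing K) := (IsLocalRing.maximalIdeal (integerRing K)).toAddSubgroup
  have hPset : (P : Set (integerRing K)) = Metric.closedBall 0 ‖(ϖ : K)‖ :=
    Irreducible.maximalIdeal_eq_closedBall hϖ
  have hindex : P.index = Nat.card (IsLocalRing.ResidueField (integerRing K)) := rfl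
  have hfin : P.FiniteIndex := by
    refine ⟨?_⟩
    rw [hindex]
    exact Nat.card_pos.ne'
  have hemb : MeasurableEmbedding (Subtype.val : (integerRing K) → K) := MeasurableEmbedding.subtype_coe hOmeas
  let μ : Measure (integerRing K) := da.comap Subtype.val
  have hμ : ∀ S : Set (integerRing K), μ S = da (Subtype.val '' S) := fun S => hemb.comap_apply da S
  have hinv : μ.IsAddLeftInvariant := by
    refine ⟨fun g => ?_⟩
    ext S hS
    rw [Measure.map_apply (measurable_const_add g) hS, hμ, hμ]
    have : (Subtype.val : (integerRing K) → K) '' ((fun x => g + x) ⁻¹' S)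
        = (fun x => (g : K) + x) ⁻¹' (Subtype.val '' S) := by
      ext y
      constructor
      · rintro ⟨z, hz, rfl⟩
        exact ⟨g + z, hz, rfl⟩
      · rintro ⟨z, hz, hzy⟩
        exact ⟨z - g, by simpa using hz, by simp [hzy]⟩
    rw [this, measure_preimage_add]
  have h := AddSubgroup.index_mul_measure P
    (by rw [hPset]; exact Metric.isClosed_closedBall.measurableSet) μ
  rw [hindex, hμ, hμ, Set.image_univ, Subtype.range_coe, hPset] at h
  have h1 : (Subtype.val : (integerRing K) → K) '' Metric.closedBall 0 ‖(ϖ : K)‖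
      = Metric.closedBall 0 ‖(ϖ : K)‖ := by
    ext y
    constructor
    · rintro ⟨z, hz, rfl⟩
      simpa using hz
    · intro hy
      have hy' : ‖y‖ ≤ ‖(ϖ : K)‖ := by simpa using hy
      have hy1 : y ∈ (integerRing K) := Valued.integer.mem_iff.mpr
        (hy'.trans (Valued.integer.norm_le_one ϖ))
      exact ⟨⟨y, hy1⟩, by simpa using hy', rfl⟩
  rw [h1] at h
  rw [h]
  congr 1

/-- Both the modulus and the norm are multiplicative, so it suffices to compare them on elements of
norm one and on a uniformizer. -/
theorem normIsModulus_of_uniformizer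
    (hnorm : ∀ ϖ : (integerRing K), Irreducible ϖ →
      ‖(ϖ : K)‖ =
        (Nat.card (IsLocalRing.ResidueField (integerRing K)) : ℝ)⁻¹)
    (da : Measure K) [da.IsAddHaarMeasure] : NormIsModulus K := by
  have := isDiscreteValuationRing_integer (K := K)
  obtain ⟨ϖ, hϖ⟩ := IsDiscreteValuationRing.exists_irreducible
    (integerRing K)
  have hϖ0 : (ϖ : K) ≠ 0 := fun h => hϖ.ne_zero (Subtype.ext h)
  have hq := hnorm ϖ hϖ
  -- `Nat.card` of an infinite type is $0$, which would give a uniformizer norm $0$. Finiteness of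
  -- the residue field is thus forced by the normalization.
  have hcard : Nat.card (IsLocalRing.ResidueField (integerRing K)) ≠ 0 := by
    intro h0
    rw [h0] at hq
    rw [Nat.cast_zero, _root_.inv_zero, norm_eq_zero] at hq
    exact hϖ0 hq
  have : Finite (IsLocalRing.ResidueField (integerRing K)) :=
    Nat.finite_of_card_ne_zero hcard
  have hchar : ∀ x : Kˣ, ‖(x : K)‖ = 1 → distribHaarChar K x = 1 := by
    intro x hx
    apply distribHaarChar_eq_of_closedBall da x
    simp [hx]
  have hunif : distribHaarChar K (Units.mk0 (ϖ : K) hϖ0) = ‖(ϖ : K)‖₊ := by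
    apply distribHaarChar_eq_of_closedBall da
    rw [← card_residueField_mul_measure da hϖ, ← mul_assoc]
    have : (‖(ϖ : K)‖₊ : ℝ≥0∞) *
        (Nat.card (IsLocalRing.ResidueField (integerRing K)) : ℝ≥0∞)
        = 1 := by
      have h1 : ‖(ϖ : K)‖₊ *
        (Nat.card (IsLocalRing.ResidueField (integerRing K)) : ℝ≥0) = 1 := by
        rw [← NNReal.coe_inj]
        push_cast
        rw [hq, inv_mul_cancel₀ (by exact_mod_cast hcard)]
      exact_mod_cast h1
    rw [this, one_mul]
    rfl
  intro x
  obtain ⟨m, hm⟩ := exists_norm_eq_zpow hϖ x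
  set w := Units.mk0 (ϖ : K) hϖ0
  have hx : x = w ^ m * (x * (w ^ m)⁻¹) := by rw [mul_comm x, mul_inv_cancel_left]
  have h1 : ‖((x * (w ^ m)⁻¹ : Kˣ) : K)‖ = 1 := by
    rw [Units.val_mul, norm_mul, hm]
    simp only [Units.val_inv_eq_inv_val, Units.val_zpow_eq_zpow_val, norm_inv, norm_zpow, w,
      Units.val_mk0]
    exact mul_inv_cancel₀ (zpow_ne_zero _ (norm_ne_zero_iff.mpr hϖ0))
  rw [hx, map_mul, hchar _ h1, mul_one, map_zpow, hunif, ← NNReal.coe_inj, Units.val_mul, nnnorm_mul,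
    NNReal.coe_mul, coe_nnnorm (((x * (w ^ m)⁻¹ : Kˣ) : K)), h1, mul_one]
  simp [w]

end Modulus

/-! ### Linear maps scale Haar measure on a product by the norm of the determinant. -/

section LinearMaps

open scoped Pointwise NNReal ENNReal

variable {K : Type*} [NontriviallyNormedField K] [ProperSpace K] [MeasurableSpace K] [BorelSpace K]

theorem NormIsModulus.measure_preimage_mul (hK : NormIsModulus K) (da : Measure K)
    [da.IsAddHaarMeasure] (x : Kˣ) (S : Set K) :
    da ((fun y => (x : K) * y) ⁻¹' S) = (‖(x : K)‖₊⁻¹ : ℝ≥0) * da S := by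
  have h : (fun y => (x : K) * y) ⁻¹' S = x⁻¹ • S := by
    ext y
    rw [Set.mem_smul_set_iff_inv_smul_mem]
    simp [Units.smul_def]
  rw [h, ← distribHaarChar_mul, map_inv, hK x]

variable {ι : Type*} [Fintype ι] [DecidableEq ι]

theorem measurable_toLin' (M : Matrix ι ι K) : Measurable (Matrix.toLin' M) :=
  (LinearMap.continuous_on_pi _).measurable

theorem NormIsModulus.map_diagonal (hK : NormIsModulus K) (da : Measure K)
    [da.IsAddHaarMeasure] (D : ι → K) (hD : (Matrix.diagonal D).det ≠ 0) :
    Measure.map (Matrix.toLin' (Matrix.diagonal D)) (Measure.pi fun _ => da)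
      = (‖(Matrix.diagonal D).det‖₊⁻¹ : ℝ≥0) • Measure.pi fun _ : ι => da := by
  have hD' : ∀ i, D i ≠ 0 := by
    intro i hi
    apply hD
    rw [Matrix.det_diagonal]
    exact Finset.prod_eq_zero (Finset.mem_univ i) hi
  have hc : ‖(Matrix.diagonal D).det‖₊ ≠ 0 := nnnorm_ne_zero_iff.mpr hD
  -- The determinant is moved to this side so that `Measure.pi_eq` applies, which characterizes the
  -- product measure by its values on boxes.
  have key : Measure.pi (fun _ : ι => da) = ‖(Matrix.diagonal D).det‖₊ •
      Measure.map (Matrix.toLin' (Matrix.diagonal D)) (Measure.pi fun _ => da) := by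
    refine Measure.pi_eq fun s hs => ?_
    rw [Measure.smul_apply, Measure.map_apply (measurable_toLin' _)
      (MeasurableSet.univ_pi hs)]
    have hpre : (Matrix.toLin' (Matrix.diagonal D)) ⁻¹' (Set.univ.pi s)
        = Set.univ.pi fun i => (fun y => ((Units.mk0 (D i) (hD' i) : Kˣ) : K) * y) ⁻¹' s i := by
      ext v
      simp [Matrix.mulVec_diagonal]
    rw [hpre, Measure.pi_pi]
    simp_rw [hK.measure_preimage_mul, Units.val_mk0]
    rw [Finset.prod_mul_distrib, Matrix.det_diagonal, nnnorm_prod, ENNReal.smul_def, smul_eq_mul,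
      ← mul_assoc, ← ENNReal.ofNNReal_finsetProd, ← ENNReal.coe_mul, ← Finset.prod_mul_distrib,
      Finset.prod_eq_one fun i _ => mul_inv_cancel₀ (by simpa using hD' i)]
    simp
  conv_rhs => rw [key]
  rw [smul_smul, inv_mul_cancel₀ hc, one_smul]

theorem measurePreserving_transvection (da : Measure K) [da.IsAddHaarMeasure]
    (t : Matrix.TransvectionStruct ι K) :
    MeasurePreserving (Matrix.toLin' t.toMatrix) (Measure.pi fun _ => da)
      (Measure.pi fun _ => da) := by
  have ht : Measurable (Matrix.toLin' t.toMatrix) := measurable_toLin' _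
  refine ⟨ht, ?_⟩
  refine (Measure.pi_eq fun s hs ↦ ?_).symm
  have h2s : MeasurableSet (Set.univ.pi s) := .pi Set.countable_univ fun i _ ↦ hs i
  simp_rw [← Measure.pi_pi, ← lintegral_indicator_one h2s]
  rw [lintegral_map (measurable_one.indicator h2s) ht]
  -- A transvection changes only coordinate `t.i`, by a translation depending on the others, so
  -- integrating this coordinate first removes it.
  refine lintegral_eq_of_lmarginal_eq {t.i} ((measurable_one.indicator h2s).comp ht)
    (measurable_one.indicator h2s) ?_
  simp_rw [lmarginal_singleton]
  ext x
  cases t with | mk t_i t_j t_hij t_c =>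
  simp [transvection, single_mulVec, t_hij.symm, ← Function.update_add,
    lintegral_add_right_eq_self fun xᵢ ↦ Set.indicator (Set.univ.pi s) 1 (Function.update x t_i xᵢ)]

theorem NormIsModulus.map_toLin' (hK : NormIsModulus K) (da : Measure K)
    [da.IsAddHaarMeasure] (M : Matrix ι ι K) (hM : M.det ≠ 0) :
    Measure.map (Matrix.toLin' M) (Measure.pi fun _ => da)
      = (‖M.det‖₊⁻¹ : ℝ≥0) • Measure.pi fun _ : ι => da := by
  apply diagonal_transvection_induction_of_det_ne_zero _ M hM
  · exact fun D hD => hK.map_diagonal da D hD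
  · intro t
    rw [Matrix.TransvectionStruct.det, (measurePreserving_transvection da t).map_eq]
    simp
  · intro A B _ _ IHA IHB
    rw [toLin'_mul, det_mul, LinearMap.coe_comp, ← Measure.map_map (measurable_toLin' _)
      (measurable_toLin' _), IHB, Measure.map_smul, IHA, smul_smul, nnnorm_mul, mul_inv, mul_comm]

theorem NormIsModulus.measurePreserving_vecMul (hK : NormIsModulus K) (da : Measure K)
    [da.IsAddHaarMeasure] (M : Matrix ι ι K) (hM : ‖M.det‖ = 1) :
    MeasurePreserving (fun v : ι → K => v ᵥ* M) (Measure.pi fun _ => da)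
      (Measure.pi fun _ => da) := by
  have h : (fun v : ι → K => v ᵥ* M) = Matrix.toLin' Mᵀ := by
    ext v : 1
    simp [Matrix.mulVec_transpose]
  have h1 : ‖Mᵀ.det‖₊ = 1 := by
    rw [Matrix.det_transpose, ← NNReal.coe_inj]
    exact hM
  have h0 : Mᵀ.det ≠ 0 := by
    rw [← nnnorm_ne_zero_iff, h1]
    exact one_ne_zero
  rw [h]
  refine ⟨measurable_toLin' _, ?_⟩
  rw [hK.map_toLin' da _ h0, h1, inv_one, one_smul]

/-- Scaling of the product measure. -/
theorem NormIsModulus.map_units_smul_pi (hK : NormIsModulus K) (da : Measure K)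
    [da.IsAddHaarMeasure] (x : Kˣ) :
    Measure.map (fun v : ι → K => (x : K) • v) (Measure.pi fun _ => da)
      = ((‖(x : K)‖₊ ^ Fintype.card ι)⁻¹ : ℝ≥0) • Measure.pi fun _ : ι => da := by
  have hdet : (Matrix.diagonal fun _ : ι => (x : K)).det = (x : K) ^ Fintype.card ι := by
    simp [Matrix.det_diagonal]
  have h := hK.map_diagonal da (fun _ : ι => (x : K)) (by rw [hdet]; exact pow_ne_zero _ x.ne_zero)
  rw [hdet, nnnorm_pow] at h
  rw [← h]
  congr 1
  ext v i
  simp [Matrix.mulVec_diagonal]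

end LinearMaps

/-! ### The topology of the multiplicative group and integrals of powers of the norm. -/

section Units

open scoped NNReal ENNReal

variable {K : Type*} [NontriviallyNormedField K]

instance instBorelSpaceUnits [MeasurableSpace K] [BorelSpace K] : BorelSpace Kˣ :=
  ⟨by
    rw [Units.isEmbedding_val₀.isInducing.eq_induced, borel_comap,
      ← BorelSpace.measurable_eq (α := K)]
    rfl⟩

instance instSecondCountableUnits [ProperSpace K] : SecondCountableTopology Kˣ :=
  Units.isEmbedding_val₀.secondCountableTopology

instance instLocallyCompactUnits [ProperSpace K] : LocallyCompactSpace Kˣ :=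
  Units.isOpenEmbedding_val.locallyCompactSpace

theorem units_norm_pos (t : Kˣ) : 0 < ‖(t : K)‖ := norm_pos_iff.mpr t.ne_zero

theorem isCompact_units_annulus [ProperSpace K] {r R : ℝ} (hr : 0 < r) :
    IsCompact {t : Kˣ | r ≤ ‖(t : K)‖ ∧ ‖(t : K)‖ ≤ R} := by
  rw [Units.isEmbedding_val₀.isCompact_iff]
  have h : (Units.val '' {t : Kˣ | r ≤ ‖(t : K)‖ ∧ ‖(t : K)‖ ≤ R})
      = {x : K | r ≤ ‖x‖} ∩ Metric.closedBall 0 R := by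
    ext x
    constructor
    · rintro ⟨t, ⟨h1, h2⟩, rfl⟩
      exact ⟨h1, by simpa using h2⟩
    · rintro ⟨h1, h2⟩
      have hx : x ≠ 0 := norm_pos_iff.mp (hr.trans_le h1)
      exact ⟨Units.mk0 x hx, ⟨h1, by simpa using h2⟩, rfl⟩
  rw [h]
  exact (isCompact_closedBall _ _).inter_left (isClosed_le continuous_const continuous_norm)

/-- Since $1$ is not isolated, Haar measure on $k^\times$ has no atoms; `measure_sq_mul_eq_one`
depends on this. -/
instance instNeBotUnits : (nhdsWithin (1 : Kˣ) {1}ᶜ).NeBot := by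
  have h := Units.isOpenEmbedding_val (R := K) |>.isOpenMap
  rw [← mem_closure_iff_nhdsWithin_neBot, mem_closure_iff]
  intro U hU h1
  have hV := h U hU
  have hmem : (1 : K) ∈ Units.val '' U := ⟨1, h1, rfl⟩
  have hne : (nhdsWithin (1 : K) {1}ᶜ).NeBot := inferInstance
  rw [← mem_closure_iff_nhdsWithin_neBot, mem_closure_iff] at hne
  obtain ⟨_, ⟨t, htU, rfl⟩, ht1⟩ := hne _ hV hmem
  exact ⟨t, htU, fun h => ht1 (by simp [Set.mem_singleton_iff.mp h])⟩

/-- The unit with a given nonzero value (and `1` at zero). -/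
def toUnit (x : K) : Kˣ := open Classical in if h : x = 0 then 1 else Units.mk0 x h

theorem val_toUnit {x : K} (hx : x ≠ 0) : (toUnit x : K) = x := by
  simp [toUnit, hx]

theorem toUnit_val (t : Kˣ) : toUnit (t : K) = t := by
  ext; exact val_toUnit t.ne_zero

theorem continuousAt_toUnit {x : K} (hx : x ≠ 0) : ContinuousAt (toUnit : K → Kˣ) x := by
  rw [Units.isEmbedding_val₀.isInducing.continuousAt_iff]
  refine continuousAt_id.congr ?_
  filter_upwards [isOpen_ne.mem_nhds hx] with y hy
  exact (val_toUnit hy).symm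

variable [MeasurableSpace K] [BorelSpace K]

theorem measurable_toUnit : Measurable (toUnit : K → Kˣ) := by
  classical
  refine measurable_comap_iff.mpr ?_
  have h : (Units.val ∘ toUnit : K → K) = fun x => if x = 0 then 1 else x := by
    ext x
    by_cases hx : x = 0
    · simp [toUnit, hx]
    · simp [val_toUnit hx, hx]
  rw [h]
  exact Measurable.ite (measurableSet_singleton 0) measurable_const measurable_id

theorem measurable_units_val : Measurable (Units.val : Kˣ → K) :=
  Units.continuous_val.measurable

theorem measurable_units_norm : Measurable fun t : Kˣ => ‖(t : K)‖ :=
  measurable_units_val.norm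

variable [ProperSpace K] (dt : Measure Kˣ) [dt.IsHaarMeasure]

/-- The annuli $r^{m+1}<|t|\le r^m$ are translates of one another, so they share one finite volume,
and the integral is dominated by a geometric series of ratio $r^\sigma<1$. -/
theorem lintegral_norm_rpow_unit_ball {σ : ℝ} (hσ : 0 < σ) :
    ∫⁻ t in {t : Kˣ | ‖(t : K)‖ ≤ 1}, ENNReal.ofReal (‖(t : K)‖ ^ σ) ∂dt < ∞ := by
  obtain ⟨ϖ, hϖ0, hϖ1⟩ := NormedField.exists_norm_lt_one K
  set r := ‖ϖ‖
  have hϖ : ϖ ≠ 0 := norm_pos_iff.mp hϖ0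
  let w : Kˣ := Units.mk0 ϖ hϖ
  let A : ℕ → Set Kˣ := fun m => {t | r ^ (m + 1) < ‖(t : K)‖ ∧ ‖(t : K)‖ ≤ r ^ m}
  have hAmeas : ∀ m, MeasurableSet (A m) := fun m =>
    (measurableSet_lt measurable_const measurable_units_norm).inter
      (measurableSet_le measurable_units_norm measurable_const)
  have hA : ∀ m, dt (A m) = dt (A 0) := by
    intro m
    have : A 0 = (fun t => w ^ m * t) ⁻¹' A m := by
      ext t
      have hr : 0 < r ^ m := pow_pos hϖ0 m
      simp only [A, Set.mem_ofPred_eq, Set.mem_preimage, Units.val_mul, Units.val_pow_eq_pow_val,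
        norm_mul, norm_pow, w, Units.val_mk0]
      change _ ↔ r ^ (m + 1) < r ^ m * _ ∧ r ^ m * _ ≤ r ^ m
      rw [pow_succ r m, mul_lt_mul_iff_right₀ hr, mul_le_iff_le_one_right hr, zero_add, pow_one,
        pow_zero]
    rw [this, measure_preimage_mul]
  have hM : dt (A 0) < ∞ :=
    (measure_mono (t := {t : Kˣ | r ≤ ‖(t : K)‖ ∧ ‖(t : K)‖ ≤ r ^ 0})
      (fun t ht => ⟨by simpa using ht.1.le, ht.2⟩)).trans_lt
      (isCompact_units_annulus hϖ0).measure_lt_top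
  have hcover : {t : Kˣ | ‖(t : K)‖ ≤ 1} ⊆ ⋃ m, A m := by
    intro t ht
    obtain ⟨m, h1, h2⟩ := exists_nat_pow_near_of_lt_one (units_norm_pos t) ht hϖ0 hϖ1
    exact Set.mem_iUnion.mpr ⟨m, h1, h2⟩
  calc ∫⁻ t in {t : Kˣ | ‖(t : K)‖ ≤ 1}, ENNReal.ofReal (‖(t : K)‖ ^ σ) ∂dt
      ≤ ∫⁻ t in ⋃ m, A m, ENNReal.ofReal (‖(t : K)‖ ^ σ) ∂dt := lintegral_mono_set hcover
    _ ≤ ∑' m, ∫⁻ t in A m, ENNReal.ofReal (‖(t : K)‖ ^ σ) ∂dt := lintegral_iUnion_le _ _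
    _ ≤ ∑' m : ℕ, ENNReal.ofReal (r ^ σ) ^ m * dt (A 0) := by
        refine ENNReal.tsum_le_tsum fun m => ?_
        rw [← hA m, ← setLIntegral_const]
        refine setLIntegral_mono measurable_const fun t ht => ?_
        rw [← ENNReal.ofReal_pow (by positivity)]
        refine ENNReal.ofReal_le_ofReal ?_
        calc ‖(t : K)‖ ^ σ ≤ (r ^ m) ^ σ := Real.rpow_le_rpow (norm_nonneg _) ht.2 hσ.le
          _ = (r ^ σ) ^ m := by
            rw [← Real.rpow_natCast, ← Real.rpow_natCast, ← Real.rpow_mul hϖ0.le,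
              ← Real.rpow_mul hϖ0.le, mul_comm]
    _ < ∞ := by
        rw [ENNReal.tsum_mul_right, ENNReal.tsum_geometric]
        refine ENNReal.mul_lt_top ?_ hM
        rw [ENNReal.inv_lt_top]
        have h1 : ENNReal.ofReal (r ^ σ) < 1 :=
          ENNReal.ofReal_lt_one.mpr (Real.rpow_lt_one hϖ0.le hϖ1 hσ)
        simpa using h1

theorem lintegral_norm_rpow_ball {σ : ℝ} (hσ : 0 < σ) (R : ℝ) :
    ∫⁻ t in {t : Kˣ | ‖(t : K)‖ ≤ R}, ENNReal.ofReal (‖(t : K)‖ ^ σ) ∂dt < ∞ := by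
  obtain ⟨c, hc⟩ := NormedField.exists_lt_norm K (max R 1)
  have hc0 : c ≠ 0 := norm_pos_iff.mp ((lt_of_lt_of_le one_pos (le_max_right _ _)).trans hc)
  let u : Kˣ := Units.mk0 c hc0
  have hmeas : MeasurableSet {t : Kˣ | ‖(t : K)‖ ≤ R} :=
    measurableSet_le measurable_units_norm measurable_const
  have hmeas1 : MeasurableSet {t : Kˣ | ‖(t : K)‖ ≤ 1} :=
    measurableSet_le measurable_units_norm measurable_const
  rw [← lintegral_indicator hmeas, ← lintegral_mul_left_eq_self _ u]
  calc _ ≤ ∫⁻ t, ENNReal.ofReal (‖c‖ ^ σ) * {t : Kˣ | ‖(t : K)‖ ≤ 1}.indicator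
          (fun t => ENNReal.ofReal (‖(t : K)‖ ^ σ)) t ∂dt := by
        refine lintegral_mono fun t => ?_
        by_cases ht : u * t ∈ {t : Kˣ | ‖(t : K)‖ ≤ R}
        swap
        · rw [Set.indicator_of_notMem ht]
          exact bot_le
        rw [Set.indicator_of_mem ht]
        have ht' : ‖c‖ * ‖(t : K)‖ ≤ R := by simpa [u] using ht
        have ht1 : ‖(t : K)‖ ≤ 1 := by
          by_contra! h
          have := (le_max_left R 1).trans_lt hc
          nlinarith [norm_nonneg c]
        rw [Set.indicator_of_mem (by exact ht1), ← ENNReal.ofReal_mul (by positivity)]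
        simp [u, Real.mul_rpow]
    _ < ∞ := by
        rw [lintegral_const_mul _ (Measurable.indicator (by
          exact (measurable_units_norm.pow_const σ).ennreal_ofReal) hmeas1),
          lintegral_indicator hmeas1]
        exact ENNReal.mul_lt_top ENNReal.ofReal_lt_top (lintegral_norm_rpow_unit_ball dt hσ)

end Units

/-! ### Invariant measures in the coordinates $(\lambda,a)$. -/

section CellMeasure

open scoped NNReal ENNReal

theorem setOf_forall_norm_le_one {K : Type*} [NormedField K] {n : ℕ} :
    {a : Fin n → K | ∀ i, ‖a i‖ ≤ 1} = Set.univ.pi fun _ => Metric.closedBall (0 : K) 1 := by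
  ext a
  simp

theorem isCompact_units_sphere {K : Type*} [NontriviallyNormedField K] [ProperSpace K] : IsCompact {l : Kˣ | ‖(l : K)‖ = 1} := by
  have h := isCompact_units_annulus (K := K) (r := 1) (R := 1) one_pos
  convert h using 1
  ext l
  exact ⟨fun h => ⟨h.ge, h.le⟩, fun h => le_antisymm h.2 h.1⟩

variable {K : Type*} [NontriviallyNormedField K] [ProperSpace K] [MeasurableSpace K] [BorelSpace K]
  {n : ℕ}

/-- The measure `|λ|^n d^×λ da` on `k^× × k^n`. -/
def cellMeasure (da : Measure K) (dt : Measure Kˣ) (n : ℕ) : Measure (Kˣ × (Fin n → K)) :=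
  (dt.withDensity fun l => (‖(l : K)‖₊ : ℝ≥0∞) ^ n).prod (Measure.pi fun _ => da)

/-- The right translations of `k^× × k^n`, identified with the group of all `m_λ n_a`. -/
def cellShift (l : Kˣ) (b : Fin n → K) (p : Kˣ × (Fin n → K)) : Kˣ × (Fin n → K) :=
  (p.1 * l, (l⁻¹ : K) • p.2 + b)

/-- `𝔬^× × 𝔬^n`. -/
def cellUnit (K : Type*) [NontriviallyNormedField K] (n : ℕ) : Set (Kˣ × (Fin n → K)) :=
  {l : Kˣ | ‖(l : K)‖ = 1} ×ˢ {a | ∀ i, ‖a i‖ ≤ 1}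

theorem isCompact_integral_vectors : IsCompact {a : Fin n → K | ∀ i, ‖a i‖ ≤ 1} := by
  rw [setOf_forall_norm_le_one]
  exact isCompact_univ_pi fun _ => isCompact_closedBall _ _

theorem measurableSet_integral_vectors : MeasurableSet {a : Fin n → K | ∀ i, ‖a i‖ ≤ 1} :=
  isCompact_integral_vectors.measurableSet

theorem measure_integral_vectors (da : Measure K) [da.IsAddHaarMeasure]
    (hda : da {x : K | ‖x‖ ≤ 1} = 1) :
    (Measure.pi fun _ : Fin n => da) {a : Fin n → K | ∀ i, ‖a i‖ ≤ 1} = 1 := by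
  have h : Metric.closedBall (0 : K) 1 = {x : K | ‖x‖ ≤ 1} := by ext; simp
  rw [setOf_forall_norm_le_one, Measure.pi_pi, h, hda, Finset.prod_const_one]

theorem isCompact_cellUnit : IsCompact (cellUnit K n) :=
  isCompact_units_sphere.prod isCompact_integral_vectors

variable (da : Measure K) [da.IsAddHaarMeasure] (dt : Measure Kˣ) [dt.IsHaarMeasure]
  (ν : Measure (Kˣ × (Fin n → K))) [IsFiniteMeasureOnCompacts ν]

/-- For fixed $E$, the measure $A\mapsto\nu(E\times A)$ is translation invariant, hence a multiple
of Haar measure. The compact set $C\supseteq E$ makes it finite on compacts;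
`prod_eq_of_translation_invariant` removes it by exhaustion. -/
theorem prod_eq_of_translation_invariant_of_subset_compact (hda : da {x : K | ‖x‖ ≤ 1} = 1)
    (hν : ∀ (b : Fin n → K) (S : Set (Kˣ × (Fin n → K))), MeasurableSet S →
      ν ((fun p => (p.1, b + p.2)) ⁻¹' S) = ν S)
    {E C : Set Kˣ} (hE : MeasurableSet E) (hC : IsCompact C) (hEC : E ⊆ C)
    {A : Set (Fin n → K)} (hA : MeasurableSet A) :
    ν (E ×ˢ A) = ν (E ×ˢ {a | ∀ i, ‖a i‖ ≤ 1}) * (Measure.pi fun _ => da) A := by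
  let τ : Measure (Fin n → K) := Measure.map Prod.snd (ν.restrict (E ×ˢ Set.univ))
  have hτ : ∀ {A : Set (Fin n → K)}, MeasurableSet A → τ A = ν (E ×ˢ A) := by
    intro A hA
    rw [Measure.map_apply measurable_snd hA, Measure.restrict_apply (measurable_snd hA)]
    congr 1
    ext p
    simp [and_comm]
  have hfin : IsFiniteMeasureOnCompacts τ := by
    refine ⟨fun T hT => ?_⟩
    rw [hτ hT.measurableSet]
    exact (measure_mono (Set.prod_mono hEC subset_rfl)).trans_lt (hC.prod hT).measure_lt_top
  have hinv : τ.IsAddLeftInvariant := by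
    refine ⟨fun b => ?_⟩
    ext A hA
    rw [Measure.map_apply (measurable_const_add b) hA, hτ (measurable_const_add b hA), hτ hA,
      ← hν b (E ×ˢ A) (hE.prod hA)]
    rfl
  have h := Measure.isAddLeftInvariant_eq_smul τ (Measure.pi fun _ => da)
  set c := Measure.addHaarScalarFactor τ (Measure.pi fun _ => da)
  have h1 : ν (E ×ˢ {a | ∀ i, ‖a i‖ ≤ 1}) = c := by
    rw [← hτ measurableSet_integral_vectors, h, Measure.smul_apply,
      measure_integral_vectors da hda]
    simp
  rw [h1, ← hτ hA, h]
  rfl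

theorem exists_units_exhaustion (K : Type*) [NontriviallyNormedField K] [ProperSpace K] :
    ∃ C : ℕ → Set Kˣ, (∀ j, IsCompact (C j)) ∧ Monotone C ∧ ⋃ j, C j = Set.univ := by
  refine ⟨fun j => compactCovering Kˣ j, isCompact_compactCovering Kˣ,
    fun i j h => compactCovering_subset Kˣ h, iUnion_compactCovering Kˣ⟩

theorem prod_eq_of_translation_invariant (hda : da {x : K | ‖x‖ ≤ 1} = 1)
    (hν : ∀ (b : Fin n → K) (S : Set (Kˣ × (Fin n → K))), MeasurableSet S →
      ν ((fun p => (p.1, b + p.2)) ⁻¹' S) = ν S)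
    {E : Set Kˣ} (hE : MeasurableSet E) {A : Set (Fin n → K)} (hA : MeasurableSet A) :
    ν (E ×ˢ A) = ν (E ×ˢ {a | ∀ i, ‖a i‖ ≤ 1}) * (Measure.pi fun _ => da) A := by
  obtain ⟨C, hC, hmono, hcov⟩ := exists_units_exhaustion K
  have hsup : ∀ A : Set (Fin n → K), ν (E ×ˢ A) = ⨆ j, ν ((E ∩ C j) ×ˢ A) := by
    intro A
    have hm : Monotone fun j => (E ∩ C j) ×ˢ A := fun i j hij =>
      Set.prod_mono (Set.inter_subset_inter_right _ (hmono hij)) subset_rfl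
    rw [← hm.measure_iUnion, ← Set.iUnion_prod_const, ← Set.inter_iUnion, hcov, Set.inter_univ]
  rw [hsup, hsup, ENNReal.iSup_mul]
  congr 1
  ext j : 1
  exact prod_eq_of_translation_invariant_of_subset_compact da ν hda hν
    (hE.inter (hC j).measurableSet) (hC j) Set.inter_subset_right hA

/-- A Radon measure on `k^× × k^n` invariant under right translations by the `m_λ n_a` is
`|λ|^n d^×λ da` up to a constant. -/
theorem eq_smul_cellMeasure (hK : NormIsModulus K) (hda : da {x : K | ‖x‖ ≤ 1} = 1)
    (hdt : dt {t : Kˣ | ‖(t : K)‖ = 1} = 1)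
    (hν : ∀ (l : Kˣ) (b : Fin n → K) (S : Set (Kˣ × (Fin n → K))), MeasurableSet S →
      ν (cellShift l b ⁻¹' S) = ν S) :
    ν = ν (cellUnit K n) • cellMeasure da dt n := by
  have hprod := @prod_eq_of_translation_invariant K _ _ _ _ n da _ ν _ hda (fun b S hS => by
    rw [← hν 1 b S hS]
    congr 1
    ext p
    simp [cellShift, add_comm])
  set O : Set (Fin n → K) := {a | ∀ i, ‖a i‖ ≤ 1} with hO
  have hOm : MeasurableSet O := measurableSet_integral_vectors
  let ρ : Measure Kˣ := Measure.map Prod.fst (ν.restrict (Set.univ ×ˢ O))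
  have hρ : ∀ {E : Set Kˣ}, MeasurableSet E → ρ E = ν (E ×ˢ O) := by
    intro E hE
    rw [Measure.map_apply measurable_fst hE, Measure.restrict_apply (measurable_fst hE)]
    congr 1
    ext p
    simp
  have hρfin : IsFiniteMeasureOnCompacts ρ := by
    refine ⟨fun T hT => ?_⟩
    rw [hρ hT.measurableSet]
    exact (hT.prod isCompact_integral_vectors).measure_lt_top
  have hνρ : ν = ρ.prod (Measure.pi fun _ => da) :=
    (Measure.prod_eq fun E A hE hA => by rw [hprod hE hA, hρ hE]).symm
  have hvol : (Measure.pi fun _ => da) O = 1 := measure_integral_vectors da hda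
  -- Translation by $m_l$ also dilates $a$ by $l^{-1}$. The preimage of $\mathfrak o^n$ is
  -- $l\,\mathfrak o^n$, of volume $|l|^n$, and $\rho$ has to compensate.
  have hscale : ∀ (l : Kˣ) {E : Set Kˣ}, MeasurableSet E →
      ρ ((fun t => l * t) ⁻¹' E) = (‖(l : K)‖₊⁻¹ ^ n : ℝ≥0) * ρ E := by
    intro l E hE
    have hl : ‖(l : K)‖₊ ≠ 0 := by simp
    have h := hν l 0 (E ×ˢ O) (hE.prod hOm)
    have hpre : cellShift l 0 ⁻¹' (E ×ˢ O)
        = ((fun t => l * t) ⁻¹' E) ×ˢ ((fun a => ((l⁻¹ : Kˣ) : K) • a) ⁻¹' O) := by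
      ext p
      simp [cellShift, mul_comm]
    have hsm : Measurable fun a : Fin n → K => ((l⁻¹ : Kˣ) : K) • a := by fun_prop
    rw [hpre, hprod (measurable_const_mul l hE) (hsm hOm), ← hρ hE,
      ← hρ (measurable_const_mul l hE), ← Measure.map_apply hsm hOm, hK.map_units_smul_pi,
      Measure.smul_apply, hvol, Fintype.card_fin] at h
    have h1 : ‖(l : K)‖₊⁻¹ ^ n * (‖((l⁻¹ : Kˣ) : K)‖₊ ^ n)⁻¹ = 1 := by
      rw [Units.val_inv_eq_inv_val, nnnorm_inv, mul_inv_cancel₀ (pow_ne_zero _ (inv_ne_zero hl))]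
    rw [← h, mul_left_comm, ENNReal.smul_def, smul_eq_mul, mul_one, ← ENNReal.coe_mul, h1,
      ENNReal.coe_one, mul_one]
  let f : Kˣ → ℝ≥0 := fun l => ‖(l : K)‖₊ ^ n
  have hf : Continuous f := (Units.continuous_val.nnnorm).pow n
  have hf0 : ∀ l, f l ≠ 0 := fun l => by simp [f]
  -- Dividing by $|l|^n$ cancels the scaling of $\rho$, so $\rho'$ is a Haar measure up to a
  -- constant.
  let ρ' : Measure Kˣ := ρ.withDensity fun l => ((f l)⁻¹ : ℝ≥0)
  have hf' : Continuous fun l => (f l)⁻¹ := hf.inv₀ hf0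
  have hmap : ∀ l, Measure.map (fun t => l * t) ρ = (f l)⁻¹ • ρ := by
    intro l
    ext E hE
    rw [Measure.map_apply (measurable_const_mul l) hE, hscale l hE, Measure.smul_apply]
    simp [f, ENNReal.smul_def]
  have hloc : IsLocallyFiniteMeasure ρ := inferInstance
  have hloc' : IsLocallyFiniteMeasure ρ' := IsLocallyFiniteMeasure.withDensity_coe hf'
  have hinv : ρ'.IsMulLeftInvariant := by
    refine ⟨fun l => ?_⟩
    ext E hE
    have hlE := measurable_const_mul l hE
    rw [Measure.map_apply (measurable_const_mul l) hE, withDensity_apply _ hlE,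
      withDensity_apply _ hE, ← lintegral_indicator hlE, ← lintegral_indicator hE]
    have hm : Measurable (E.indicator fun l => (((f l)⁻¹ : ℝ≥0) : ℝ≥0∞)) :=
      (measurable_coe_nnreal_ennreal.comp hf'.measurable).indicator hE
    have h1 : ∀ t, ((fun x => l * x) ⁻¹' E).indicator (fun l => (((f l)⁻¹ : ℝ≥0) : ℝ≥0∞)) t
        = (f l : ℝ≥0∞) * E.indicator (fun l => (((f l)⁻¹ : ℝ≥0) : ℝ≥0∞)) (l * t) := by
      intro t
      by_cases ht : l * t ∈ E
      · rw [Set.indicator_of_mem ht, Set.indicator_of_mem (by exact ht), ← ENNReal.coe_mul]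
        congr 1
        simp only [f, Units.val_mul, nnnorm_mul, mul_pow, mul_inv]
        rw [mul_inv_cancel_left₀ (hf0 l)]
      · rw [Set.indicator_of_notMem ht, Set.indicator_of_notMem (by exact ht), mul_zero]
    simp_rw [h1]
    rw [lintegral_const_mul (f l : ℝ≥0∞) (show Measurable fun t =>
        E.indicator (fun l => (((f l)⁻¹ : ℝ≥0) : ℝ≥0∞)) (l * t) from
        hm.comp (measurable_const_mul l)), ← lintegral_map hm (measurable_const_mul l), hmap, lintegral_smul_measure, ENNReal.smul_def,
      smul_eq_mul, ← mul_assoc, ← ENNReal.coe_mul, mul_inv_cancel₀ (hf0 l), ENNReal.coe_one,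
      one_mul]
  have hρ' := Measure.isMulLeftInvariant_eq_smul ρ' dt
  set c := Measure.haarScalarFactor ρ' dt
  have hρeq : ρ = c • dt.withDensity fun l => (f l : ℝ≥0∞) := by
    have h1 : ρ'.withDensity (fun l => (f l : ℝ≥0∞)) = ρ := by
      have h2 := withDensity_mul (μ := ρ) (measurable_coe_nnreal_ennreal.comp hf'.measurable)
        (measurable_coe_nnreal_ennreal.comp hf.measurable)
      rw [show ρ'.withDensity (fun l => (f l : ℝ≥0∞)) = _ from h2.symm]
      convert withDensity_one (μ := ρ) using 2
      ext l
      simp only [Pi.mul_apply, Function.comp_apply, Pi.one_apply]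
      rw [← ENNReal.coe_mul, inv_mul_cancel₀ (hf0 l), ENNReal.coe_one]
    rw [← h1, hρ', ENNReal.smul_def, withDensity_smul_measure, ← ENNReal.smul_def]
  have hc : ν (cellUnit K n) = c := by
    have hE : MeasurableSet {l : Kˣ | ‖(l : K)‖ = 1} := isCompact_units_sphere.measurableSet
    rw [cellUnit, ← hρ hE, hρeq, Measure.smul_apply, withDensity_apply _ hE,
      setLIntegral_congr_fun (g := fun _ => 1) hE]
    · simp [hdt, ENNReal.smul_def]
    · intro l hl
      have : ‖(l : K)‖₊ = 1 := by rw [← NNReal.coe_inj]; exact hl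
      simp [f, this]
  rw [hc, hνρ, hρeq, cellMeasure]
  have hfc : (fun l : Kˣ => (f l : ℝ≥0∞)) = fun l : Kˣ => (‖(l : K)‖₊ : ℝ≥0∞) ^ n := by
    ext l; simp [f]
  rw [hfc, ENNReal.smul_def, Measure.prod_smul_left]

end CellMeasure

/-! ### Explicit isometries and their action on coordinates. -/

section Isometries

variable {K : Type*} [Field K] {n : ℕ} {B : Matrix (Fin n) (Fin n) K}

/-- The restriction of the form to the orthogonal complement of `e₋`, as a function of all
coordinates. -/
def qform (B : Matrix (Fin n) (Fin n) K) (v : Idx n → K) : K :=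
  2 * v (Sum.inr 0) * v (Sum.inr 1) + quad B (v ∘ Sum.inl)

theorem det_gram (B : Matrix (Fin n) (Fin n) K) : (gram B).det = B.det := by
  rw [gram, Matrix.det_fromBlocks_zero₂₁]
  simp [Matrix.det_fin_three]

/-- An isometry matrix as an element of `G`. -/
def ofIsometry (hB : B.det ≠ 0) (M : Matrix (Idx n) (Idx n) K)
    (hM : M * gram B * Mᵀ = gram B) : groupG B :=
  have h : M * (gram B * Mᵀ * (gram B)⁻¹) = 1 := by
    rw [← Matrix.mul_assoc, ← Matrix.mul_assoc, hM, Matrix.mul_nonsing_inv]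
    rwa [det_gram, isUnit_iff_ne_zero]
  ⟨⟨M, gram B * Mᵀ * (gram B)⁻¹, h, mul_eq_one_comm.mp h⟩, hM⟩

theorem vecMul_mMat (l : Kˣ) (v : Idx n → K) :
    v ᵥ* mMat n l = Sum.elim (v ∘ Sum.inl)
      ![v (Sum.inr 0) * l, v (Sum.inr 1) * (l : K)⁻¹, v (Sum.inr 2)] := by
  ext i
  rw [mMat, Matrix.vecMul_diagonal]
  rcases i with i | i
  · simp
  · fin_cases i <;> simp

theorem vecMul_nMat (a : Fin n → K) (v : Idx n → K) :
    v ᵥ* nMat B a = Sum.elim (v ∘ Sum.inl + v (Sum.inr 0) • a)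
      ![v (Sum.inr 0), v (Sum.inr 1) - (v ∘ Sum.inl) ⬝ᵥ (B *ᵥ a)
        - v (Sum.inr 0) * (2⁻¹ * quad B a), v (Sum.inr 2)] := by
  ext i
  rcases i with i | i
  · simp [nMat, Matrix.vecMul, dotProduct, Fintype.sum_sum_type, Fin.sum_univ_three,
      Matrix.one_apply]
  · fin_cases i <;>
    simp [nMat, Matrix.vecMul, dotProduct, Fintype.sum_sum_type, Fin.sum_univ_three]
    ring

/-- The element exchanging `x'` and `x`. -/
def wMat (n : ℕ) (K : Type*) [Field K] : Matrix (Idx n) (Idx n) K :=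
  Matrix.fromBlocks 1 0 0 !![0, 1, 0; 1, 0, 0; 0, 0, 1]

theorem vecMul_wMat (v : Idx n → K) :
    v ᵥ* wMat n K = Sum.elim (v ∘ Sum.inl) ![v (Sum.inr 1), v (Sum.inr 0), v (Sum.inr 2)] := by
  ext i
  rcases i with i | i
  · simp [wMat, Matrix.vecMul, dotProduct, Fintype.sum_sum_type, Matrix.one_apply]
  · fin_cases i <;>
    simp [wMat, Matrix.vecMul, dotProduct, Fintype.sum_sum_type, Fin.sum_univ_three]

/-- The bilinear form on `k^{n+3}`. -/
theorem dotProduct_gram_mulVec (v w : Idx n → K) :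
    v ⬝ᵥ (gram B *ᵥ w) = (v ∘ Sum.inl) ⬝ᵥ (B *ᵥ (w ∘ Sum.inl)) + v (Sum.inr 0) * w (Sum.inr 1)
      + v (Sum.inr 1) * w (Sum.inr 0) - v (Sum.inr 2) * w (Sum.inr 2) := by
  simp [gram, dotProduct, Matrix.mulVec, Fintype.sum_sum_type, Fin.sum_univ_three]
  ring

theorem isometry_of_vecMul (M : Matrix (Idx n) (Idx n) K)
    (h : ∀ v w : Idx n → K, (v ᵥ* M) ⬝ᵥ (gram B *ᵥ (w ᵥ* M)) = v ⬝ᵥ (gram B *ᵥ w)) :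
    M * gram B * Mᵀ = gram B := by
  ext i j
  have h1 := h (Pi.single i 1) (Pi.single j 1)
  rw [← Matrix.mulVec_transpose M (Pi.single j 1), Matrix.mulVec_mulVec,
    ← Matrix.dotProduct_mulVec, Matrix.mulVec_mulVec] at h1
  simpa [Matrix.mul_assoc] using h1

theorem dotProduct_mulVec_comm (hsymm : B.IsSymm) (a b : Fin n → K) :
    a ⬝ᵥ (B *ᵥ b) = b ⬝ᵥ (B *ᵥ a) := by
  rw [Matrix.dotProduct_mulVec, ← Matrix.mulVec_transpose, hsymm.eq, dotProduct_comm]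

theorem quad_add (hsymm : B.IsSymm) (a b : Fin n → K) :
    quad B (a + b) = quad B a + 2 * (a ⬝ᵥ (B *ᵥ b)) + quad B b := by
  simp only [quad, Matrix.mulVec_add, dotProduct_add, add_dotProduct]
  rw [dotProduct_mulVec_comm hsymm b a]
  ring

theorem quad_smul (c : K) (a : Fin n → K) : quad B (c • a) = c ^ 2 * quad B a := by
  simp only [quad, Matrix.mulVec_smul, dotProduct_smul, smul_dotProduct, smul_eq_mul]
  ring

theorem isometry_mMat (l : Kˣ) : mMat n l * gram B * (mMat n l)ᵀ = gram B := by
  refine isometry_of_vecMul _ fun v w => ?_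
  have hl := l.ne_zero
  rw [dotProduct_gram_mulVec, dotProduct_gram_mulVec, vecMul_mMat, vecMul_mMat]
  simp only [Sum.elim_comp_inl, Sum.elim_inr, Matrix.cons_val]
  field_simp

theorem isometry_nMat (h2 : (2 : K) ≠ 0) (hsymm : B.IsSymm) (a : Fin n → K) :
    nMat B a * gram B * (nMat B a)ᵀ = gram B := by
  refine isometry_of_vecMul _ fun v w => ?_
  rw [dotProduct_gram_mulVec, dotProduct_gram_mulVec, vecMul_nMat, vecMul_nMat]
  simp only [Sum.elim_comp_inl, Sum.elim_inr, Matrix.cons_val, Matrix.mulVec_add,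
    Matrix.mulVec_smul, dotProduct_add, add_dotProduct, dotProduct_smul, smul_dotProduct,
    smul_eq_mul]
  rw [dotProduct_mulVec_comm hsymm a (w ∘ Sum.inl), ← quad]
  field_simp
  ring

theorem isometry_wMat : wMat n K * gram B * (wMat n K)ᵀ = gram B := by
  refine isometry_of_vecMul _ fun v w => ?_
  rw [dotProduct_gram_mulVec, dotProduct_gram_mulVec, vecMul_wMat, vecMul_wMat]
  simp only [Sum.elim_comp_inl, Sum.elim_inr, Matrix.cons_val]
  ring

theorem isometry_mul {M N : Matrix (Idx n) (Idx n) K} (hM : M * gram B * Mᵀ = gram B)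
    (hN : N * gram B * Nᵀ = gram B) : M * N * gram B * (M * N)ᵀ = gram B := by
  calc M * N * gram B * (M * N)ᵀ = M * (N * gram B * Nᵀ) * Mᵀ := by
        rw [Matrix.transpose_mul]; simp only [Matrix.mul_assoc]
    _ = gram B := by rw [hN, hM]

theorem dotProduct_gram_act (v w : Idx n → K) (g : groupG B) :
    act v g ⬝ᵥ (gram B *ᵥ act w g) = v ⬝ᵥ (gram B *ᵥ w) := by
  have hg : ((g : GL (Idx n) K) : Matrix (Idx n) (Idx n) K) * gram B
      * ((g : GL (Idx n) K) : Matrix (Idx n) (Idx n) K)ᵀ = gram B := g.2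
  rw [act, act, ← Matrix.mulVec_transpose _ w, Matrix.mulVec_mulVec, ← Matrix.dotProduct_mulVec,
    Matrix.mulVec_mulVec, ← Matrix.mul_assoc, hg]

/-- Determinants in the isometry relation give $\det(g)^2\det B=\det B$. This is why $G$ preserves
additive Haar measure on $k^{n+3}$. -/
theorem norm_det_groupG {K : Type*} [NormedField K] {B : Matrix (Fin n) (Fin n) K}
    (hB : B.det ≠ 0) (g : groupG B) :
    ‖((g : GL (Idx n) K) : Matrix (Idx n) (Idx n) K).det‖ = 1 := by
  have hg : ((g : GL (Idx n) K) : Matrix (Idx n) (Idx n) K) * gram B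
      * ((g : GL (Idx n) K) : Matrix (Idx n) (Idx n) K)ᵀ = gram B := g.2
  have h := congrArg (fun M => ‖Matrix.det M‖) hg
  simp only [Matrix.det_mul, Matrix.det_transpose, norm_mul, det_gram] at h
  have hB' : 0 < ‖B.det‖ := norm_pos_iff.mpr hB
  have h1 : ‖((g : GL (Idx n) K) : Matrix (Idx n) (Idx n) K).det‖ ^ 2 = 1 := by
    apply mul_right_cancel₀ hB'.ne'
    linarith
  exact (pow_eq_one_iff_of_nonneg (norm_nonneg _) two_ne_zero).mp h1

theorem act_groupH_inr_two (v : Idx n → K) (h : groupH B) :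
    act v (h : groupG B) (Sum.inr 2) = v (Sum.inr 2) := by
  have h1 : act eMinus (h : groupG B) = eMinus := h.2
  have h3 := dotProduct_gram_act v eMinus (h : groupG B)
  rw [h1, dotProduct_gram_mulVec, dotProduct_gram_mulVec] at h3
  have h0 : (eMinus : Idx n → K) ∘ Sum.inl = 0 := by ext; simp [eMinus]
  simpa [h0, eMinus] using h3

theorem qform_act_groupH (v : Idx n → K) (h : groupH B) :
    qform B (act v (h : groupG B)) = qform B v := by
  have h3 := dotProduct_gram_act v v (h : groupG B)
  rw [dotProduct_gram_mulVec, dotProduct_gram_mulVec, act_groupH_inr_two] at h3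
  rw [qform, qform, quad, quad]
  linear_combination h3

theorem mem_groupH_of_vecMul (hB : B.det ≠ 0) (M : Matrix (Idx n) (Idx n) K)
    (hM : M * gram B * Mᵀ = gram B) (h : eMinus ᵥ* M = eMinus) : ofIsometry hB M hM ∈ groupH B := h

theorem vecMul_nMat_eMinus (a : Fin n → K) : eMinus ᵥ* nMat B a = eMinus := by
  rw [vecMul_nMat]
  ext i
  rcases i with i | i
  · simp [eMinus]
  · fin_cases i <;> simp [eMinus, dotProduct]

theorem vecMul_mMat_eMinus (l : Kˣ) : (eMinus : Idx n → K) ᵥ* mMat n l = eMinus := by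
  rw [vecMul_mMat]
  ext i
  rcases i with i | i
  · simp [eMinus]
  · fin_cases i <;> simp [eMinus]

theorem vecMul_wMat_eMinus : (eMinus : Idx n → K) ᵥ* wMat n K = eMinus := by
  rw [vecMul_wMat]
  ext i
  rcases i with i | i
  · simp [eMinus]
  · fin_cases i <;> simp [eMinus]

/-- The element `m_λ n_a` of `H`. -/
def cellElt (hB : B.det ≠ 0) (h2 : (2 : K) ≠ 0) (hsymm : B.IsSymm) (p : Kˣ × (Fin n → K)) :
    groupH B :=
  ⟨ofIsometry hB (mMat n p.1 * nMat B p.2)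
    (isometry_mul (isometry_mMat p.1) (isometry_nMat h2 hsymm p.2)),
    mem_groupH_of_vecMul hB _ _ (by
      rw [← Matrix.vecMul_vecMul, vecMul_mMat_eMinus, vecMul_nMat_eMinus])⟩

/-- The element `n_b w` of `H`, with `w` exchanging `x'` and `x`. -/
def flipElt (hB : B.det ≠ 0) (h2 : (2 : K) ≠ 0) (hsymm : B.IsSymm) (b : Fin n → K) : groupH B :=
  ⟨ofIsometry hB (nMat B b * wMat n K)
    (isometry_mul (isometry_nMat h2 hsymm b) isometry_wMat),
    mem_groupH_of_vecMul hB _ _ (by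
      rw [← Matrix.vecMul_vecMul, vecMul_nMat_eMinus, vecMul_wMat_eMinus])⟩

variable (hB : B.det ≠ 0) (h2 : (2 : K) ≠ 0) (hsymm : B.IsSymm)

theorem act_flipElt_inr_zero (b : Fin n → K) (v : Idx n → K) :
    act v (flipElt hB h2 hsymm b : groupG B) (Sum.inr 0)
      = v (Sum.inr 1) - (v ∘ Sum.inl) ⬝ᵥ (B *ᵥ b) - v (Sum.inr 0) * (2⁻¹ * quad B b) := by
  change (v ᵥ* (nMat B b * wMat n K)) (Sum.inr 0) = _
  rw [← Matrix.vecMul_vecMul, vecMul_wMat, vecMul_nMat]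
  simp

theorem act_flipElt_inr_one (b : Fin n → K) (v : Idx n → K) :
    act v (flipElt hB h2 hsymm b : groupG B) (Sum.inr 1) = v (Sum.inr 0) := by
  change (v ᵥ* (nMat B b * wMat n K)) (Sum.inr 1) = _
  rw [← Matrix.vecMul_vecMul, vecMul_wMat, vecMul_nMat]
  simp

theorem act_cellElt (p : Kˣ × (Fin n → K)) (v : Idx n → K) :
    act v (cellElt hB h2 hsymm p : groupG B) = (v ᵥ* mMat n p.1) ᵥ* nMat B p.2 := by
  rw [Matrix.vecMul_vecMul]
  rfl

/-- The vector `e₊ m_λ n_a`. -/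
def cellVec (B : Matrix (Fin n) (Fin n) K) (p : Kˣ × (Fin n → K)) : Idx n → K :=
  Sum.elim ((p.1 : K) • p.2)
    ![(p.1 : K), 2⁻¹ * (p.1 : K)⁻¹ - (p.1 : K) * (2⁻¹ * quad B p.2), 0]

theorem act_ePlus_cellElt (p : Kˣ × (Fin n → K)) :
    act ePlus (cellElt hB h2 hsymm p : groupG B) = cellVec B p := by
  rw [act_cellElt, vecMul_mMat, vecMul_nMat, cellVec]
  ext i
  rcases i with i | i
  · simp [ePlus]
  · fin_cases i <;> simp [ePlus]

theorem cellVec_inr_zero (p : Kˣ × (Fin n → K)) : cellVec B p (Sum.inr 0) = p.1 := by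
  simp [cellVec]

theorem cellVec_inl (p : Kˣ × (Fin n → K)) : cellVec B p ∘ Sum.inl = (p.1 : K) • p.2 := by
  simp [cellVec]

/-- A vector `v` on the quadric with nonzero `x'`-coordinate is determined by its other
coordinates. -/
theorem eq_of_qform_eq (h2 : (2 : K) ≠ 0) {v w : Idx n → K} (hv : v (Sum.inr 0) ≠ 0)
    (h0 : v (Sum.inr 0) = w (Sum.inr 0)) (hl : v ∘ Sum.inl = w ∘ Sum.inl)
    (hm : v (Sum.inr 2) = w (Sum.inr 2)) (hq : qform B v = qform B w) : v = w := by
  rw [qform, qform, hl, ← h0] at hq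
  ext i
  rcases i with i | i
  · exact congrFun hl i
  · fin_cases i
    · exact h0
    · exact mul_left_cancel₀ (mul_ne_zero h2 hv) (add_right_cancel hq)
    · exact hm

theorem qform_ePlus (h2 : (2 : K) ≠ 0) : qform B ePlus = 1 := by
  have h0 : (ePlus : Idx n → K) ∘ Sum.inl = 0 := by ext; simp [ePlus]
  simp [qform, ePlus, h2, quad]

theorem qform_cellVec (h2 : (2 : K) ≠ 0) (p : Kˣ × (Fin n → K)) : qform B (cellVec B p) = 1 := by
  have hl := p.1.ne_zero
  rw [qform, cellVec_inl, quad_smul, cellVec_inr_zero]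
  simp only [cellVec, Sum.elim_inr, Matrix.cons_val]
  field_simp
  ring

end Isometries

/-! ### The homogeneous space as a quadric. -/

section HomogeneousSpace

variable {K : Type*} [Field K] {n : ℕ} {B : Matrix (Fin n) (Fin n) K}

/-- The map `Θh ↦ e₊h` from `Θ\H` to `k^{n+3}`. -/
def ThetaH.vec : ThetaH B → Idx n → K :=
  Quotient.lift (fun h : groupH B => act ePlus (h : groupG B)) (by
    intro x y hxy
    have hxy' : act ePlus ((y * x⁻¹ : groupH B) : groupG B) = ePlus :=
      QuotientGroup.rightRel_apply.mp hxy
    change act ePlus (x : groupG B) = act ePlus (y : groupG B)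
    conv_lhs => rw [← hxy']
    rw [← act_mul]
    simp)

theorem ThetaH.vec_mk (h : groupH B) : (ThetaH.mk h).vec = act ePlus (h : groupG B) := rfl

theorem ThetaH.exists_mk (c : ThetaH B) : ∃ h, ThetaH.mk h = c := Quotient.exists_rep c

theorem ThetaH.vec_rmul (h : groupH B) (c : ThetaH B) :
    (ThetaH.rmul h c).vec = act c.vec (h : groupG B) := by
  obtain ⟨x, rfl⟩ := c.exists_mk
  exact act_mul _ _ _

/-- If $e_+x=e_+y$, then $yx^{-1}$ fixes $e_+$ and so lies in $\varTheta$. Identities in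
$\varTheta\backslash H$ can therefore be checked on vectors. -/
theorem ThetaH.vec_injective : Function.Injective (ThetaH.vec : ThetaH B → Idx n → K) := by
  intro c d hcd
  obtain ⟨x, rfl⟩ := c.exists_mk
  obtain ⟨y, rfl⟩ := d.exists_mk
  refine Quotient.sound ?_
  change QuotientGroup.rightRel (groupTheta B) _ _
  rw [QuotientGroup.rightRel_apply]
  change act ePlus ((y * x⁻¹ : groupH B) : groupG B) = ePlus
  rw [vec_mk, vec_mk] at hcd
  rw [Subgroup.coe_mul, act_mul, ← hcd, ← act_mul]
  simp [act_one]

theorem ThetaH.rmul_rmul (h k : groupH B) (c : ThetaH B) :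
    ThetaH.rmul k (ThetaH.rmul h c) = ThetaH.rmul (h * k) c := by
  apply vec_injective
  rw [vec_rmul, vec_rmul, vec_rmul, ← act_mul]
  rfl

theorem ThetaH.rmul_one (c : ThetaH B) : ThetaH.rmul 1 c = c := by
  apply vec_injective
  rw [vec_rmul]
  exact act_one _

theorem ThetaH.vec_inr_two (c : ThetaH B) : c.vec (Sum.inr 2) = 0 := by
  obtain ⟨x, rfl⟩ := c.exists_mk
  rw [vec_mk, act_groupH_inr_two]
  simp [ePlus]

theorem ThetaH.qform_vec (h2 : (2 : K) ≠ 0) (c : ThetaH B) : qform B c.vec = 1 := by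
  obtain ⟨x, rfl⟩ := c.exists_mk
  rw [vec_mk, qform_act_groupH, qform_ePlus h2]

/-- The coset `Θ m_λ n_a`. -/
def cellMap (hB : B.det ≠ 0) (h2 : (2 : K) ≠ 0) (hsymm : B.IsSymm) (p : Kˣ × (Fin n → K)) :
    ThetaH B := ThetaH.mk (cellElt hB h2 hsymm p)

variable (hB : B.det ≠ 0) (h2 : (2 : K) ≠ 0) (hsymm : B.IsSymm)

theorem vec_cellMap (p : Kˣ × (Fin n → K)) : (cellMap hB h2 hsymm p).vec = cellVec B p :=
  act_ePlus_cellElt hB h2 hsymm p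

end HomogeneousSpace

/-! ### Coordinates on the open cell. -/

section CellCoordinates

variable {K : Type*} [NontriviallyNormedField K] {n : ℕ} {B : Matrix (Fin n) (Fin n) K}

/-- The coordinates `(λ, a)` of a vector `λ x' + λ a + ⋯`. -/
def cellCoord (v : Idx n → K) : Kˣ × (Fin n → K) :=
  (toUnit (v (Sum.inr 0)), (v (Sum.inr 0))⁻¹ • (v ∘ Sum.inl))

theorem cellCoord_cellVec (p : Kˣ × (Fin n → K)) : cellCoord (cellVec B p) = p := by
  rw [cellCoord, cellVec_inl, cellVec_inr_zero, toUnit_val, inv_smul_smul₀ p.1.ne_zero]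

theorem cellVec_cellCoord (h2 : (2 : K) ≠ 0) {v : Idx n → K} (hv : v (Sum.inr 0) ≠ 0)
    (hm : v (Sum.inr 2) = 0) (hq : qform B v = 1) : cellVec B (cellCoord v) = v := by
  refine (eq_of_qform_eq (B := B) h2 hv ?_ ?_ ?_ ?_).symm
  · rw [cellVec_inr_zero, cellCoord, val_toUnit hv]
  · rw [cellVec_inl, cellCoord, val_toUnit hv, smul_inv_smul₀ hv]
  · rw [hm]; simp [cellVec]
  · rw [hq, qform_cellVec h2]

variable (hB : B.det ≠ 0) (h2 : (2 : K) ≠ 0) (hsymm : B.IsSymm)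

theorem cellMap_cellCoord_vec {c : ThetaH B} (hc : c.vec (Sum.inr 0) ≠ 0) :
    cellMap hB h2 hsymm (cellCoord c.vec) = c := by
  apply ThetaH.vec_injective
  rw [vec_cellMap, cellVec_cellCoord h2 hc c.vec_inr_two (c.qform_vec h2)]

/-- This is the relation $m_\lambda n_am_ln_b=m_{\lambda l}n_{l^{-1}a+b}$, read off on $e_+$. Both
sides lie on the quadric, so the $x$-coordinate need not be compared. -/
theorem rmul_cellElt_cellMap (l : Kˣ) (b : Fin n → K) (p : Kˣ × (Fin n → K)) :
    ThetaH.rmul (cellElt hB h2 hsymm (l, b)) (cellMap hB h2 hsymm p)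
      = cellMap hB h2 hsymm (cellShift l b p) := by
  apply ThetaH.vec_injective
  have h0 : (ThetaH.rmul (cellElt hB h2 hsymm (l, b)) (cellMap hB h2 hsymm p)).vec (Sum.inr 0)
      = p.1 * l := by
    rw [ThetaH.vec_rmul, vec_cellMap, act_cellElt, vecMul_nMat, vecMul_mMat]
    simp [cellVec]
  refine eq_of_qform_eq (B := B) h2 ?_ ?_ ?_ ?_ ?_
  · rw [h0]
    exact mul_ne_zero p.1.ne_zero l.ne_zero
  · rw [h0, vec_cellMap, cellVec_inr_zero]
    simp [cellShift]
  · rw [vec_cellMap, cellVec_inl, ThetaH.vec_rmul, vec_cellMap, act_cellElt, vecMul_nMat,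
      vecMul_mMat]
    have hl := l.ne_zero
    ext i
    simp only [cellVec, cellShift, Sum.elim_comp_inl, Sum.elim_inr, Matrix.cons_val, Pi.add_apply,
      Pi.smul_apply, smul_eq_mul, Units.val_mul]
    field_simp
  · rw [ThetaH.vec_inr_two, ThetaH.vec_inr_two]
  · rw [ThetaH.qform_vec h2, ThetaH.qform_vec h2]

theorem vec_rmul_cellElt_inr_zero (l : Kˣ) (b : Fin n → K) (c : ThetaH B) :
    (ThetaH.rmul (cellElt hB h2 hsymm (l, b)) c).vec (Sum.inr 0) = c.vec (Sum.inr 0) * l := by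
  rw [ThetaH.vec_rmul, act_cellElt, vecMul_nMat, vecMul_mMat]
  simp

/-- The $k^n$-component of $e_+m_\lambda n_a$ is $\lambda a$, and for $|\lambda|=1$ it is integral
exactly when $a$ is. -/
theorem mem_unitCell_iff (hB : B.det ≠ 0) (h2 : (2 : K) ≠ 0) (hsymm : B.IsSymm) {c : ThetaH B} :
    c ∈ unitCell B ↔ ‖c.vec (Sum.inr 0)‖ = 1 ∧ ∀ i, ‖c.vec (Sum.inl i)‖ ≤ 1 := by
  constructor
  · rintro ⟨h, l, a, hl, ha, hM, rfl⟩
    have hv : (ThetaH.mk h).vec = cellVec B (l, a) := by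
      rw [ThetaH.vec_mk, ← act_ePlus_cellElt hB h2 hsymm]
      change ePlus ᵥ* (((h : groupG B) : GL (Idx n) K) : Matrix (Idx n) (Idx n) K) = _
      rw [hM]
      rfl
    rw [hv]
    refine ⟨by rw [cellVec_inr_zero]; exact hl, fun i => ?_⟩
    have := congrFun (cellVec_inl (B := B) (l, a)) i
    simp only [Function.comp_apply, Pi.smul_apply, smul_eq_mul] at this
    rw [this, norm_mul, hl, one_mul]
    exact ha i
  · rintro ⟨h0, hl⟩
    have hne : c.vec (Sum.inr 0) ≠ 0 := by
      intro h; rw [h, norm_zero] at h0; exact zero_ne_one h0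
    refine ⟨cellElt hB h2 hsymm (cellCoord c.vec), (cellCoord c.vec).1, (cellCoord c.vec).2, ?_, ?_,
      rfl, (cellMap_cellCoord_vec hB h2 hsymm hne).symm⟩
    · rw [cellCoord, val_toUnit hne, h0]
    · intro i
      simp only [cellCoord, Pi.smul_apply, smul_eq_mul, norm_mul, norm_inv, h0, Function.comp_apply]
      simpa using hl i

end CellCoordinates

/-! ### Transitivity on the quadric and its topology. -/

section Topology

open Topology

variable {K : Type*} [NontriviallyNormedField K] {n : ℕ} {B : Matrix (Fin n) (Fin n) K}

theorem continuous_groupG_val :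
    Continuous fun g : groupG B => ((g : GL (Idx n) K) : Matrix (Idx n) (Idx n) K) :=
  Units.continuous_val.comp continuous_subtype_val

theorem continuous_act (v : Idx n → K) : Continuous fun g : groupG B => act v g :=
  continuous_const.matrix_vecMul continuous_groupG_val

theorem continuous_act_vec (g : groupG B) : Continuous fun v : Idx n → K => act v g :=
  continuous_id.matrix_vecMul continuous_const

theorem ThetaH.continuous_mk : Continuous (ThetaH.mk : groupH B → ThetaH B) :=
  continuous_quotient_mk'

theorem ThetaH.continuous_vec : Continuous (ThetaH.vec : ThetaH B → Idx n → K) :=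
  Continuous.quotient_lift ((continuous_act ePlus).comp continuous_subtype_val) _

theorem ThetaH.continuous_rmul (h : groupH B) : Continuous (ThetaH.rmul h) :=
  Continuous.quotient_lift (ThetaH.continuous_mk.comp (continuous_mul_const h)) _

theorem continuous_ofIsometry {X : Type*} [TopologicalSpace X] (hB : B.det ≠ 0)
    {f : X → Matrix (Idx n) (Idx n) K} (hf : Continuous f)
    (h : ∀ x, f x * gram B * (f x)ᵀ = gram B) :
    Continuous fun x => ofIsometry hB (f x) (h x) := by
  have hinv : Continuous fun x => gram B * (f x)ᵀ * (gram B)⁻¹ :=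
    (continuous_const.matrix_mul hf.matrix_transpose).matrix_mul continuous_const
  have h1 : Continuous fun x => (ofIsometry hB (f x) (h x) : GL (Idx n) K) :=
    Units.continuous_iff.mpr ⟨by exact hf, by exact hinv⟩
  exact Continuous.subtype_mk h1 _

theorem continuous_quad (B : Matrix (Fin n) (Fin n) K) : Continuous (quad B) := by
  unfold quad
  exact continuous_id.dotProduct (continuous_const.matrix_mulVec continuous_id)

theorem continuous_qform (B : Matrix (Fin n) (Fin n) K) : Continuous (qform B) := by
  unfold qform
  have h1 : Continuous fun v : Idx n → K => v ∘ Sum.inl := by fun_prop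
  have h2 := (continuous_quad B).comp h1
  simp only [Function.comp_def] at h2 ⊢
  fun_prop

theorem continuous_mMat : Continuous (mMat n : Kˣ → Matrix (Idx n) (Idx n) K) := by
  unfold mMat
  refine Continuous.matrix_diagonal (continuous_pi fun i => ?_)
  rcases i with i | i
  · exact continuous_const
  · have h1 : Continuous fun l : Kˣ => (l : K)⁻¹ :=
      Units.continuous_val.inv₀ fun l => l.ne_zero
    fin_cases i
    · exact Units.continuous_val
    · exact h1
    · exact continuous_const

theorem continuous_nMat (B : Matrix (Fin n) (Fin n) K) : Continuous (nMat B) := by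
  have hq := continuous_quad B
  have hv : Continuous fun a : Fin n → K => B *ᵥ a :=
    continuous_const.matrix_mulVec continuous_id
  unfold nMat
  refine Continuous.matrix_fromBlocks continuous_const ?_ ?_ ?_
  · refine continuous_matrix fun i j => ?_
    fin_cases j
    · exact continuous_const
    · exact ((continuous_apply i).comp hv).neg
    · exact continuous_const
  · refine continuous_matrix fun i j => ?_
    fin_cases i
    · exact continuous_apply j
    · exact continuous_const
    · exact continuous_const
  · refine continuous_matrix fun i j => ?_
    fin_cases i <;> fin_cases j
    · exact continuous_const
    · exact (continuous_const.mul hq).neg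
    all_goals exact continuous_const

variable (hB : B.det ≠ 0) (h2 : (2 : K) ≠ 0) (hsymm : B.IsSymm)

theorem continuous_cellMap : Continuous (cellMap hB h2 hsymm) := by
  refine ThetaH.continuous_mk.comp (Continuous.subtype_mk ?_ _)
  exact continuous_ofIsometry hB ((continuous_mMat.comp continuous_fst).matrix_mul
    ((continuous_nMat B).comp continuous_snd)) _

theorem continuousAt_cellCoord {v : Idx n → K} (hv : v (Sum.inr 0) ≠ 0) :
    ContinuousAt cellCoord v := by
  have h0 : ContinuousAt (fun v : Idx n → K => v (Sum.inr 0)) v :=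
    (continuous_apply _).continuousAt
  have h1 : Continuous fun v : Idx n → K => v ∘ Sum.inl := by fun_prop
  refine ContinuousAt.prodMk ?_ ((h0.inv₀ hv).smul h1.continuousAt)
  exact ContinuousAt.comp (f := fun v : Idx n → K => v (Sum.inr 0)) (continuousAt_toUnit hv) h0

theorem measurable_cellCoord [SecondCountableTopology K] [MeasurableSpace K] [BorelSpace K] :
    Measurable (cellCoord : (Idx n → K) → Kˣ × (Fin n → K)) := by
  have h0 : Measurable (fun v : Idx n → K => v (Sum.inr 0)) := measurable_pi_apply _
  have h1 : Measurable fun v : Idx n → K => v ∘ Sum.inl :=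
    measurable_pi_lambda _ fun i => measurable_pi_apply _
  exact (measurable_toUnit.comp h0).prodMk (h0.inv.smul h1)

/-- A vector of the quadric with vanishing `x'`-coordinate is moved off this hyperplane by some
`n_b w`, where `b` may be taken from any given dense set. -/
theorem exists_flipElt_inr_zero_ne_zero {D : Set (Fin n → K)} (hD : Dense D) {v : Idx n → K}
    (h0 : v (Sum.inr 0) = 0) (hq : qform B v = 1) :
    ∃ b ∈ D, act v (flipElt hB h2 hsymm b : groupG B) (Sum.inr 0) ≠ 0 := by
  simp only [act_flipElt_inr_zero, h0, zero_mul, sub_zero]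
  have hopen : IsOpen {b : Fin n → K | v (Sum.inr 1) - (v ∘ Sum.inl) ⬝ᵥ (B *ᵥ b) ≠ 0} := by
    have hc : Continuous fun b : Fin n → K => v (Sum.inr 1) - (v ∘ Sum.inl) ⬝ᵥ (B *ᵥ b) :=
      continuous_const.sub
        (continuous_const.dotProduct (continuous_const.matrix_mulVec continuous_id))
    exact isOpen_ne.preimage hc
  have hQ : quad B (v ∘ Sum.inl) = 1 := by
    rw [qform, h0] at hq
    simpa using hq
  obtain ⟨b, hb, hbD⟩ := hD.exists_mem_open hopen
    -- Let $u$ be the $k^n$-component and $v_x$ the $x$-coordinate of $v$. As $B(u)=1$, the choice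
    -- $b=(v_x-1)u$ gives $v_x-\langle u,b\rangle=1$, so the open set meets $D$.
    ⟨(v (Sum.inr 1) - 1) • (v ∘ Sum.inl), by
      rw [quad] at hQ
      simp [Matrix.mulVec_smul, hQ]⟩
  exact ⟨b, hb, hbD⟩

theorem exists_act_inr_zero_ne_zero (hB : B.det ≠ 0) (h2 : (2 : K) ≠ 0) (hsymm : B.IsSymm)
    {v : Idx n → K} (hq : qform B v = 1) :
    ∃ h : groupH B, act v (h : groupG B) (Sum.inr 0) ≠ 0 := by
  by_cases h0 : v (Sum.inr 0) = 0
  · obtain ⟨b, -, hb⟩ := exists_flipElt_inr_zero_ne_zero hB h2 hsymm dense_univ h0 hq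
    exact ⟨_, hb⟩
  · exact ⟨1, by rwa [Subgroup.coe_one, act_one]⟩

/-- Transitivity of `H` on the quadric. -/
theorem ThetaH.exists_vec_eq (hB : B.det ≠ 0) (h2 : (2 : K) ≠ 0) (hsymm : B.IsSymm)
    {v : Idx n → K} (hm : v (Sum.inr 2) = 0) (hq : qform B v = 1) :
    ∃ c : ThetaH B, c.vec = v := by
  obtain ⟨h, hh⟩ := exists_act_inr_zero_ne_zero hB h2 hsymm hq
  refine ⟨ThetaH.rmul h⁻¹ (cellMap hB h2 hsymm (cellCoord (act v (h : groupG B)))), ?_⟩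
  rw [vec_rmul, vec_cellMap, cellVec_cellCoord h2 hh (by rw [act_groupH_inr_two, hm])
    (by rw [qform_act_groupH, hq]), ← act_mul]
  simp [act_one]

/-- Some $h\in H$ moves the given point into the open cell, where $(\lambda,a)$ depend continuously
on the vector; translating back by $h^{-1}$ gives a continuous local inverse of `ThetaH.vec`. -/
theorem ThetaH.isEmbedding_vec (hB : B.det ≠ 0) (h2 : (2 : K) ≠ 0) (hsymm : B.IsSymm) :
    IsEmbedding (ThetaH.vec : ThetaH B → Idx n → K) := by
  refine ⟨isInducing_iff_nhds.mpr fun c => le_antisymm ?_ ?_, vec_injective⟩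
  · exact (continuous_vec.tendsto c).le_comap
  · obtain ⟨h, hh⟩ := exists_act_inr_zero_ne_zero hB h2 hsymm (c.qform_vec h2)
    let g : (Idx n → K) → ThetaH B := fun v =>
      ThetaH.rmul h⁻¹ (cellMap hB h2 hsymm (cellCoord (act v (h : groupG B))))
    have hg : ∀ d : ThetaH B, act d.vec (h : groupG B) (Sum.inr 0) ≠ 0 → g d.vec = d := by
      intro d hd
      simp only [g]
      rw [← vec_rmul, cellMap_cellCoord_vec hB h2 hsymm (by rwa [vec_rmul]), rmul_rmul,
        mul_inv_cancel, rmul_one]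
    have hgc : ContinuousAt g c.vec := by
      refine (continuous_rmul h⁻¹).continuousAt.comp
        ((continuous_cellMap hB h2 hsymm).continuousAt.comp ?_)
      exact ContinuousAt.comp (f := fun v : Idx n → K => act v (h : groupG B))
        (continuousAt_cellCoord hh) (continuous_act_vec _).continuousAt
    intro s hs
    rw [ContinuousAt, hg c hh] at hgc
    have hU : {v : Idx n → K | act v (h : groupG B) (Sum.inr 0) ≠ 0} ∈ 𝓝 c.vec :=
      (isOpen_ne.preimage ((continuous_apply _).comp (continuous_act_vec _))).mem_nhds hh
    refine ⟨g ⁻¹' s ∩ {v | act v (h : groupG B) (Sum.inr 0) ≠ 0},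
      Filter.inter_mem (hgc hs) hU, ?_⟩
    rintro d ⟨hd1, hd2⟩
    have := hg d hd2
    rw [← this]
    exact hd1

end Topology

/-! ### Uniqueness of the invariant measure. -/

section Uniqueness

open Topology
open scoped NNReal ENNReal

variable {K : Type*} [NontriviallyNormedField K] [ProperSpace K] [MeasurableSpace K] [BorelSpace K]
  {n : ℕ} {B : Matrix (Fin n) (Fin n) K}

theorem measure_sq_mul_eq_one (dt : Measure Kˣ) [dt.IsHaarMeasure] (c : K) :
    dt {l : Kˣ | (l : K) ^ 2 * c = 1} = 0 := by
  rcases Set.eq_empty_or_nonempty {l : Kˣ | (l : K) ^ 2 * c = 1} with h | ⟨l₀, h₀⟩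
  · rw [h, measure_empty]
  · have h₀' : (l₀ : K) ^ 2 * c = 1 := h₀
    have hsub : {l : Kˣ | (l : K) ^ 2 * c = 1} ⊆ {l₀, -l₀} := by
      intro l hl
      have hl' : (l : K) ^ 2 * c = 1 := hl
      have hc : c ≠ 0 := by rintro rfl; simp at h₀'
      have : (l : K) ^ 2 = (l₀ : K) ^ 2 := mul_right_cancel₀ hc (hl'.trans h₀'.symm)
      rcases sq_eq_sq_iff_eq_or_eq_neg.mp this with h | h
      · exact Or.inl (Units.ext h)
      · exact Or.inr (Units.ext (by simpa using h))
    exact ((Set.toFinite _).subset hsub).measure_zero _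

theorem measurable_quad (B : Matrix (Fin n) (Fin n) K) : Measurable (quad B) :=
  (continuous_quad B).measurable

/-- The $x$-coordinate vanishes only if $\lambda^2B(a)=1$. For each $a$ this leaves at most two
$\lambda$, a null set, and Fubini concludes. -/
theorem cellMeasure_inr_one_eq_zero (h2 : (2 : K) ≠ 0) (da : Measure K) [da.IsAddHaarMeasure]
    (dt : Measure Kˣ) [dt.IsHaarMeasure] :
    cellMeasure da dt n {p | cellVec B p (Sum.inr 1) = 0} = 0 := by
  let S : Set (Kˣ × (Fin n → K)) := {p | (p.1 : K) ^ 2 * quad B p.2 = 1}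
  have hS : MeasurableSet S := by
    have hm : Measurable fun p : Kˣ × (Fin n → K) => (p.1 : K) ^ 2 * quad B p.2 :=
      ((measurable_units_val.comp measurable_fst).pow_const 2).mul
        ((measurable_quad B).comp measurable_snd)
    exact hm (measurableSet_singleton 1)
  have hsub : {p | cellVec B p (Sum.inr 1) = 0} ⊆ S := by
    intro p hp
    have hp' : cellVec B p (Sum.inr 1) = 0 := hp
    have hl := p.1.ne_zero
    simp only [cellVec, Sum.elim_inr, Matrix.cons_val] at hp'
    field_simp at hp'
    change (p.1 : K) ^ 2 * quad B p.2 = 1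
    linear_combination -hp'
  refine measure_mono_null hsub ?_
  rw [cellMeasure, Measure.prod_apply_symm hS]
  have h : ∀ a : Fin n → K, (dt.withDensity fun l => (‖(l : K)‖₊ : ℝ≥0∞) ^ n)
      ((fun l => (l, a)) ⁻¹' S) = 0 :=
    fun a => withDensity_absolutelyContinuous _ _ (measure_sq_mul_eq_one dt (quad B a))
  simp [h]

variable (hB : B.det ≠ 0) (h2 : (2 : K) ≠ 0) (hsymm : B.IsSymm)

/-- The measure on `k^× × k^n` obtained from a measure on `Θ\H` by restriction to the open cell. -/
def cellRestrict (μ : Measure (ThetaH B)) : Measure (Kˣ × (Fin n → K)) :=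
  Measure.map (fun c => cellCoord c.vec) (μ.restrict {c | c.vec (Sum.inr 0) ≠ 0})

theorem isOpen_cell : IsOpen {c : ThetaH B | c.vec (Sum.inr 0) ≠ 0} :=
  isOpen_ne.preimage ((continuous_apply _).comp ThetaH.continuous_vec)

theorem measurable_cellCoord_vec : Measurable fun c : ThetaH B => cellCoord c.vec :=
  measurable_cellCoord.comp ThetaH.continuous_vec.measurable

theorem cellRestrict_apply (μ : Measure (ThetaH B)) {S : Set (Kˣ × (Fin n → K))}
    (hS : MeasurableSet S) :
    cellRestrict μ S = μ ({c | c.vec (Sum.inr 0) ≠ 0 ∧ cellCoord c.vec ∈ S}) := by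
  rw [cellRestrict, Measure.map_apply measurable_cellCoord_vec hS,
    Measure.restrict_apply (measurable_cellCoord_vec hS)]
  congr 1
  ext c
  simp [and_comm]

theorem measurable_cellMap : Measurable (cellMap hB h2 hsymm) :=
  (continuous_cellMap hB h2 hsymm).measurable

theorem map_cellMap_cellRestrict (μ : Measure (ThetaH B)) :
    Measure.map (cellMap hB h2 hsymm) (cellRestrict μ)
      = μ.restrict {c | c.vec (Sum.inr 0) ≠ 0} := by
  ext S hS
  rw [Measure.map_apply (measurable_cellMap hB h2 hsymm) hS,
    cellRestrict_apply μ (measurable_cellMap hB h2 hsymm hS), Measure.restrict_apply hS]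
  congr 1
  ext c
  constructor
  · rintro ⟨h0, hc⟩
    rw [Set.mem_preimage, cellMap_cellCoord_vec hB h2 hsymm h0] at hc
    exact ⟨hc, h0⟩
  · rintro ⟨hc, h0⟩
    refine ⟨h0, ?_⟩
    rwa [Set.mem_preimage, cellMap_cellCoord_vec hB h2 hsymm h0]

theorem isFiniteMeasureOnCompacts_cellRestrict (hB : B.det ≠ 0) (h2 : (2 : K) ≠ 0)
    (hsymm : B.IsSymm) (μ : Measure (ThetaH B)) [IsFiniteMeasureOnCompacts μ] :
    IsFiniteMeasureOnCompacts (cellRestrict μ) := by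
  refine ⟨fun T hT => ?_⟩
  rw [cellRestrict_apply μ hT.measurableSet]
  refine (measure_mono ?_).trans_lt
    (hT.image (continuous_cellMap hB h2 hsymm)).measure_lt_top
  rintro c ⟨h0, hc⟩
  exact ⟨_, hc, cellMap_cellCoord_vec hB h2 hsymm h0⟩

theorem cellCoord_rmul_cellElt (l : Kˣ) (b : Fin n → K) {c : ThetaH B}
    (hc : c.vec (Sum.inr 0) ≠ 0) :
    cellCoord (ThetaH.rmul (cellElt hB h2 hsymm (l, b)) c).vec
      = cellShift l b (cellCoord c.vec) := by
  conv_lhs => rw [← cellMap_cellCoord_vec hB h2 hsymm hc]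
  rw [rmul_cellElt_cellMap, vec_cellMap, cellCoord_cellVec]

theorem cellRestrict_preimage_cellShift (hB : B.det ≠ 0) (h2 : (2 : K) ≠ 0)
    (hsymm : B.IsSymm) {μ : Measure (ThetaH B)} (hμ : IsPeriodMeasure B μ) (l : Kˣ) (b : Fin n → K)
    {S : Set (Kˣ × (Fin n → K))} (hS : MeasurableSet S) :
    cellRestrict μ (cellShift l b ⁻¹' S) = cellRestrict μ S := by
  have hshift : Measurable (cellShift l b : Kˣ × (Fin n → K) → _) := by
    unfold cellShift
    exact (measurable_fst.mul_const l).prodMk ((measurable_snd.const_smul ((l : K)⁻¹)).add_const b)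
  rw [cellRestrict_apply μ hS, cellRestrict_apply μ (hshift hS)]
  have hm : MeasurableSet {c : ThetaH B | c.vec (Sum.inr 0) ≠ 0 ∧ cellCoord c.vec ∈ S} :=
    isOpen_cell.measurableSet.inter (measurable_cellCoord_vec hS)
  rw [← hμ.invariant (cellElt hB h2 hsymm (l, b)) _ hm]
  congr 1
  ext c
  simp only [Set.mem_ofPred_eq, Set.mem_preimage, vec_rmul_cellElt_inr_zero]
  constructor
  · rintro ⟨h0, hc⟩
    exact ⟨mul_ne_zero h0 l.ne_zero, by rwa [cellCoord_rmul_cellElt hB h2 hsymm l b h0]⟩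
  · rintro ⟨h0, hc⟩
    have h0' := left_ne_zero_of_mul h0
    exact ⟨h0', by rwa [cellCoord_rmul_cellElt hB h2 hsymm l b h0'] at hc⟩

theorem cellRestrict_cellUnit (hB : B.det ≠ 0) (h2 : (2 : K) ≠ 0)
    (hsymm : B.IsSymm) (μ : Measure (ThetaH B)) :
    cellRestrict μ (cellUnit K n) = μ (unitCell B) := by
  rw [cellRestrict_apply μ isCompact_cellUnit.measurableSet]
  congr 1
  ext c
  rw [mem_unitCell_iff hB h2 hsymm]
  constructor
  · rintro ⟨h0, hl, ha⟩
    have hl' : ‖c.vec (Sum.inr 0)‖ = 1 := by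
      simpa [cellCoord, val_toUnit h0] using hl
    refine ⟨hl', fun i => ?_⟩
    simpa [cellCoord, hl'] using ha i
  · rintro ⟨h0, hl⟩
    have hne : c.vec (Sum.inr 0) ≠ 0 := by
      intro h; rw [h, norm_zero] at h0; exact zero_ne_one h0
    refine ⟨hne, ?_, fun i => ?_⟩
    · simpa [cellCoord, val_toUnit hne] using h0
    · simpa [cellCoord, h0] using hl i

theorem IsPeriodMeasure.cellRestrict_eq (hK : NormIsModulus K) (da : Measure K)
    [da.IsAddHaarMeasure] (hda : da {x : K | ‖x‖ ≤ 1} = 1) (dt : Measure Kˣ) [dt.IsHaarMeasure]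
    (hdt : dt {t : Kˣ | ‖(t : K)‖ = 1} = 1) (hB : B.det ≠ 0) (h2 : (2 : K) ≠ 0)
    (hsymm : B.IsSymm) {μ : Measure (ThetaH B)} (hμ : IsPeriodMeasure B μ) :
    cellRestrict μ = cellMeasure da dt n := by
  have := hμ.finiteOnCompacts
  have := isFiniteMeasureOnCompacts_cellRestrict hB h2 hsymm μ
  rw [eq_smul_cellMeasure da dt (cellRestrict μ) hK hda hdt
    fun l b S hS => cellRestrict_preimage_cellShift hB h2 hsymm hμ l b hS,
    cellRestrict_cellUnit hB h2 hsymm, hμ.normalized, one_smul]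

/-- The complement of the open cell is a null set for the invariant measure. -/
theorem IsPeriodMeasure.measure_compl_cell (hK : NormIsModulus K) (da : Measure K)
    [da.IsAddHaarMeasure] (hda : da {x : K | ‖x‖ ≤ 1} = 1) (dt : Measure Kˣ) [dt.IsHaarMeasure]
    (hdt : dt {t : Kˣ | ‖(t : K)‖ = 1} = 1) (hB : B.det ≠ 0) (h2 : (2 : K) ≠ 0)
    (hsymm : B.IsSymm) {μ : Measure (ThetaH B)} (hμ : IsPeriodMeasure B μ) :
    μ {c | c.vec (Sum.inr 0) ≠ 0}ᶜ = 0 := by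
  have hc1 : Continuous fun c : ThetaH B => c.vec (Sum.inr 1) :=
    (continuous_apply _).comp ThetaH.continuous_vec
  have hZ : MeasurableSet {c : ThetaH B | c.vec (Sum.inr 1) = 0} :=
    (isClosed_singleton.preimage hc1).measurableSet
  have hnull : μ ({c | c.vec (Sum.inr 1) = 0} ∩ {c | c.vec (Sum.inr 0) ≠ 0}) = 0 := by
    rw [← Measure.restrict_apply hZ, ← map_cellMap_cellRestrict hB h2 hsymm,
      hμ.cellRestrict_eq hK da hda dt hdt hB h2 hsymm,
      Measure.map_apply (measurable_cellMap hB h2 hsymm) hZ]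
    have hpre : cellMap hB h2 hsymm ⁻¹' {c | c.vec (Sum.inr 1) = 0}
        = {p | cellVec B p (Sum.inr 1) = 0} := by
      ext p
      rw [Set.mem_preimage, Set.mem_ofPred_eq, vec_cellMap, Set.mem_ofPred_eq]
    rw [hpre]
    exact cellMeasure_inr_one_eq_zero h2 da dt
  -- A point outside the cell has $x'$-coordinate $0$, which $n_bw$ turns into the $x$-coordinate; a
  -- suitable $b\in D$ makes the new $x'$-coordinate nonzero. Countability of $D$ keeps the union of
  -- preimages null.
  obtain ⟨D, hDc, hD⟩ := TopologicalSpace.exists_countable_dense (Fin n → K)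
  refine measure_mono_null (t := ⋃ b ∈ D, ThetaH.rmul (flipElt hB h2 hsymm b) ⁻¹'
    ({c | c.vec (Sum.inr 1) = 0} ∩ {c | c.vec (Sum.inr 0) ≠ 0})) ?_ ?_
  · intro c hc
    have hc' : c.vec (Sum.inr 0) = 0 := by simpa using hc
    obtain ⟨b, hbD, hb⟩ := exists_flipElt_inr_zero_ne_zero hB h2 hsymm hD hc' (c.qform_vec h2)
    refine Set.mem_biUnion hbD ⟨?_, ?_⟩
    · change (ThetaH.rmul _ c).vec _ = 0
      rw [ThetaH.vec_rmul, act_flipElt_inr_one, hc']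
    · change (ThetaH.rmul _ c).vec _ ≠ 0
      rwa [ThetaH.vec_rmul]
  · rw [measure_biUnion_null_iff hDc]
    intro b _
    rw [hμ.invariant _ _ (hZ.inter isOpen_cell.measurableSet), hnull]

/-- The invariant measure in the coordinates `(λ, a)`. -/
theorem IsPeriodMeasure.eq_map (hK : NormIsModulus K) (da : Measure K)
    [da.IsAddHaarMeasure] (hda : da {x : K | ‖x‖ ≤ 1} = 1) (dt : Measure Kˣ) [dt.IsHaarMeasure]
    (hdt : dt {t : Kˣ | ‖(t : K)‖ = 1} = 1) (hB : B.det ≠ 0) (h2 : (2 : K) ≠ 0)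
    (hsymm : B.IsSymm) {μ : Measure (ThetaH B)} (hμ : IsPeriodMeasure B μ) :
    μ = Measure.map (cellMap hB h2 hsymm) (cellMeasure da dt n) := by
  rw [← hμ.cellRestrict_eq hK da hda dt hdt hB h2 hsymm, map_cellMap_cellRestrict,
    Measure.restrict_eq_self_of_ae_mem]
  rw [ae_iff]
  exact hμ.measure_compl_cell hK da hda dt hdt hB h2 hsymm

end Uniqueness

/-! ### Square roots near $1$ when $2$ is a unit. -/

section SquareRoots

open Metric

variable {K : Type*} [NontriviallyNormedField K] [IsUltrametricDist K]

theorem norm_eq_one_of_mem_closedBall {ρ : ℝ} (hρ : ρ < 1) {r : K} (hr : r ∈ closedBall (1 : K) ρ) :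
    ‖r‖ = 1 := by
  have h : ‖r - 1‖ < ‖(1 : K)‖ := by
    rw [norm_one]; exact (mem_closedBall_iff_norm.mp hr).trans_lt hρ
  have h1 := IsUltrametricDist.norm_add_eq_max_of_norm_ne_norm h.ne
  rw [sub_add_cancel, max_eq_right h.le, norm_one] at h1
  exact h1

theorem norm_two_sub_add_le {ρ : ℝ} {r s : K} (hr : r ∈ closedBall (1 : K) ρ)
    (hs : s ∈ closedBall (1 : K) ρ) : ‖2 - (r + s)‖ ≤ ρ := by
  have h : 2 - (r + s) = (1 - r) + (1 - s) := by ring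
  rw [h]
  refine (IsUltrametricDist.norm_add_le_max _ _).trans (max_le ?_ ?_)
  · rw [norm_sub_rev]; exact mem_closedBall_iff_norm.mp hr
  · rw [norm_sub_rev]; exact mem_closedBall_iff_norm.mp hs

/-- Near $1$ the factor $r+s$ is close to $2$, hence of norm one, so squaring is isometric there. -/
theorem norm_sq_sub_sq (h2 : ‖(2 : K)‖ = 1) {ρ : ℝ} (hρ : ρ < 1) {r s : K}
    (hr : r ∈ closedBall (1 : K) ρ) (hs : s ∈ closedBall (1 : K) ρ) :
    ‖r ^ 2 - s ^ 2‖ = ‖r - s‖ := by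
  have h := norm_two_sub_add_le hr hs
  have h1 : ‖-(2 - (r + s))‖ ≠ ‖(2 : K)‖ := by
    rw [norm_neg, h2]; exact (h.trans_lt hρ).ne
  have h3 := IsUltrametricDist.norm_add_eq_max_of_norm_ne_norm h1
  rw [norm_neg, h2, max_eq_right (h.trans hρ.le)] at h3
  have h4 : -(2 - (r + s)) + 2 = r + s := by ring
  rw [h4] at h3
  rw [sq_sub_sq, norm_mul, h3, one_mul]

theorem exists_sq_eq [CompleteSpace K] (h2 : ‖(2 : K)‖ = 1) {ρ : ℝ} (hρ0 : 0 ≤ ρ) (hρ : ρ < 1)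
    {c : K} (hc : c ∈ closedBall (1 : K) ρ) : ∃ r ∈ closedBall (1 : K) ρ, r ^ 2 = c := by
  have h20 : (2 : K) ≠ 0 := by rw [← norm_ne_zero_iff, h2]; exact one_ne_zero
  have h1mem : (1 : K) ∈ closedBall (1 : K) ρ := mem_closedBall_self hρ0
  -- Newton's iteration with the derivative frozen at its value $2$ at $r=1$. It contracts the ball
  -- by the factor $\rho$, and its fixed points are the square roots of $c$.
  let f : K → K := fun r => r - (r ^ 2 - c) / 2
  have hf : Set.MapsTo f (closedBall (1 : K) ρ) (closedBall (1 : K) ρ) := by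
    intro r hr
    have h3 : ‖r ^ 2 - 1 ^ 2‖ ≤ ρ := by
      rw [norm_sq_sub_sq h2 hρ hr h1mem]; exact mem_closedBall_iff_norm.mp hr
    have h4 : ‖1 - c‖ ≤ ρ := by rw [norm_sub_rev]; exact mem_closedBall_iff_norm.mp hc
    have h5 : ‖r ^ 2 - c‖ ≤ ρ := by
      have : r ^ 2 - c = (r ^ 2 - 1 ^ 2) + (1 - c) := by ring
      rw [this]
      exact (IsUltrametricDist.norm_add_le_max _ _).trans (max_le h3 h4)
    rw [mem_closedBall_iff_norm]
    have h6 : f r - 1 = (r - 1) + -((r ^ 2 - c) / 2) := by simp only [f]; ring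
    rw [h6]
    refine (IsUltrametricDist.norm_add_le_max _ _).trans
      (max_le (mem_closedBall_iff_norm.mp hr) ?_)
    rwa [norm_neg, norm_div, h2, div_one]
  have hcontr : ContractingWith ⟨ρ, hρ0⟩ (hf.restrict f (closedBall (1 : K) ρ) (closedBall 1 ρ)) := by
    refine ⟨by exact_mod_cast hρ, LipschitzWith.of_dist_le_mul fun r s => ?_⟩
    rw [Subtype.dist_eq, Subtype.dist_eq, dist_eq_norm, dist_eq_norm]
    have h7 : f r - f s = (2 - ((r : K) + s)) / 2 * ((r : K) - s) := by
      simp only [f]; field_simp; ring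
    change ‖f r - f s‖ ≤ ρ * _
    rw [h7, norm_mul, norm_div, h2, div_one]
    exact mul_le_mul_of_nonneg_right (norm_two_sub_add_le r.2 s.2) (norm_nonneg _)
  have : Nonempty (closedBall (1 : K) ρ) := ⟨⟨1, h1mem⟩⟩
  have : CompleteSpace (closedBall (1 : K) ρ) := isClosed_closedBall.completeSpace_coe
  have hfix := hcontr.fixedPoint_isFixedPt
  set r := hcontr.fixedPoint
  refine ⟨r, r.2, ?_⟩
  have h8 : f r = r := congrArg Subtype.val hfix
  have h9 : ((r : K) ^ 2 - c) / 2 = 0 := by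
    simp only [f] at h8
    linear_combination -h8
  have h10 := (div_eq_zero_iff.mp h9).resolve_right h20
  exact sub_eq_zero.mp h10

/-- The square root on a ball around `1`, with values in the same ball. -/
def ballSqrt (ρ : ℝ) (c : K) : K :=
  open Classical in if h : ∃ r ∈ closedBall (1 : K) ρ, r ^ 2 = c then h.choose else 1

variable [CompleteSpace K] {ρ : ℝ}

theorem ballSqrt_mem (h2 : ‖(2 : K)‖ = 1) (hρ0 : 0 ≤ ρ) (hρ : ρ < 1) {c : K} (hc : c ∈ closedBall (1 : K) ρ) :
    ballSqrt ρ c ∈ closedBall (1 : K) ρ := by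
  have h := exists_sq_eq h2 hρ0 hρ hc
  rw [ballSqrt, dif_pos h]
  exact h.choose_spec.1

theorem ballSqrt_sq (h2 : ‖(2 : K)‖ = 1) (hρ0 : 0 ≤ ρ) (hρ : ρ < 1) {c : K} (hc : c ∈ closedBall (1 : K) ρ) : ballSqrt ρ c ^ 2 = c := by
  have h := exists_sq_eq h2 hρ0 hρ hc
  rw [ballSqrt, dif_pos h]
  exact h.choose_spec.2

theorem norm_ballSqrt (h2 : ‖(2 : K)‖ = 1) (hρ0 : 0 ≤ ρ) (hρ : ρ < 1) {c : K} (hc : c ∈ closedBall (1 : K) ρ) : ‖ballSqrt ρ c‖ = 1 :=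
  norm_eq_one_of_mem_closedBall hρ (ballSqrt_mem h2 hρ0 hρ hc)

/-- Inverse to an isometric map, the chosen root is $1$-Lipschitz; the arbitrary choice in
`ballSqrt` does no harm. -/
theorem continuousOn_ballSqrt (h2 : ‖(2 : K)‖ = 1) (hρ0 : 0 ≤ ρ) (hρ : ρ < 1) :
    ContinuousOn (ballSqrt ρ) (closedBall (1 : K) ρ) := by
  refine LipschitzOnWith.continuousOn (K := 1) (LipschitzOnWith.of_dist_le_mul fun c hc d hd => ?_)
  rw [dist_eq_norm, dist_eq_norm, ← norm_sq_sub_sq h2 hρ (ballSqrt_mem h2 hρ0 hρ hc)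
    (ballSqrt_mem h2 hρ0 hρ hd), ballSqrt_sq h2 hρ0 hρ hc, ballSqrt_sq h2 hρ0 hρ hd]
  simp

end SquareRoots

/-! ### Existence of the invariant measure, by projecting a neighbourhood of the quadric. -/

section Existence

open Topology
open scoped NNReal ENNReal

variable {K : Type*} [NontriviallyNormedField K] {n : ℕ} {B : Matrix (Fin n) (Fin n) K}

/-- A neighbourhood of the quadric, invariant under `H`. -/
def cone (B : Matrix (Fin n) (Fin n) K) (ρ : ℝ) : Set (Idx n → K) :=
  {w | ‖w (Sum.inr 2)‖ ≤ 1 ∧ qform B w ∈ Metric.closedBall 1 ρ}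

/-- The projection of the cone to the quadric. -/
def coneVec (B : Matrix (Fin n) (Fin n) K) (ρ : ℝ) (w : Idx n → K) : Idx n → K :=
  (ballSqrt ρ (qform B w))⁻¹ • (w - w (Sum.inr 2) • eMinus)

theorem coneVec_inr_two (ρ : ℝ) (w : Idx n → K) : coneVec B ρ w (Sum.inr 2) = 0 := by
  simp [coneVec, eMinus]

theorem isClosed_cone (B : Matrix (Fin n) (Fin n) K) (ρ : ℝ) : IsClosed (cone B ρ) :=
  (isClosed_le (continuous_apply _).norm continuous_const).inter
    (Metric.isClosed_closedBall.preimage (continuous_qform B))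

theorem act_mem_cone_iff {ρ : ℝ} (h : groupH B) (w : Idx n → K) :
    act w (h : groupG B) ∈ cone B ρ ↔ w ∈ cone B ρ := by
  rw [cone, Set.mem_ofPred_eq, Set.mem_ofPred_eq, act_groupH_inr_two, qform_act_groupH]

theorem coneVec_act (ρ : ℝ) (h : groupH B) (w : Idx n → K) :
    coneVec B ρ (act w (h : groupG B)) = act (coneVec B ρ w) (h : groupG B) := by
  have h1 : act eMinus (h : groupG B) = eMinus := h.2
  rw [coneVec, coneVec, qform_act_groupH, act_groupH_inr_two]
  conv_lhs => rw [← h1]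
  simp only [act, Matrix.smul_vecMul, Matrix.sub_vecMul]

/-- The coset over the projection of a vector of the cone. -/
def coneMap (B : Matrix (Fin n) (Fin n) K) (ρ : ℝ) (w : Idx n → K) : ThetaH B :=
  open Classical in
  -- The constant value off the cone serves only measurability; `coneMeasure` restricts to the cone.
  if h : w ∈ cone B ρ ∧ ∃ c : ThetaH B, c.vec = coneVec B ρ w then h.2.choose else ThetaH.mk 1

theorem two_ne_zero_of_norm (h2 : ‖(2 : K)‖ = 1) : (2 : K) ≠ 0 := by
  rw [← norm_ne_zero_iff, h2]; exact one_ne_zero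

variable [IsUltrametricDist K] [ProperSpace K] {ρ : ℝ}

theorem ballSqrt_ne_zero_of_mem_cone (h2 : ‖(2 : K)‖ = 1) (hρ0 : 0 ≤ ρ) (hρ : ρ < 1)
    {w : Idx n → K} (hw : w ∈ cone B ρ) : ballSqrt ρ (qform B w) ≠ 0 := by
  rw [← norm_ne_zero_iff, norm_ballSqrt h2 hρ0 hρ hw.2]
  exact one_ne_zero

theorem qform_coneVec (h2 : ‖(2 : K)‖ = 1) (hρ0 : 0 ≤ ρ) (hρ : ρ < 1) {w : Idx n → K}
    (hw : w ∈ cone B ρ) : qform B (coneVec B ρ w) = 1 := by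
  have h1 : ∀ (r : K) (v : Idx n → K), qform B (r • (v - v (Sum.inr 2) • eMinus))
      = r ^ 2 * qform B v := by
    intro r v
    have h0 : (r • (v - v (Sum.inr 2) • eMinus)) ∘ Sum.inl = r • (v ∘ Sum.inl) := by
      ext i; simp [eMinus]
    rw [qform, qform, h0, quad_smul]
    simp only [Pi.smul_apply, Pi.sub_apply, eMinus, Sum.elim_inr, Matrix.cons_val, smul_eq_mul]
    ring
  rw [coneVec, h1, inv_pow, ballSqrt_sq h2 hρ0 hρ hw.2, inv_mul_cancel₀]
  rw [← ballSqrt_sq h2 hρ0 hρ hw.2]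
  exact pow_ne_zero _ (ballSqrt_ne_zero_of_mem_cone h2 hρ0 hρ hw)

theorem vec_coneMap (hB : B.det ≠ 0) (h2 : ‖(2 : K)‖ = 1) (hsymm : B.IsSymm)
    (hρ0 : 0 ≤ ρ) (hρ : ρ < 1) {w : Idx n → K} (hw : w ∈ cone B ρ) :
    (coneMap B ρ w).vec = coneVec B ρ w := by
  have h : w ∈ cone B ρ ∧ ∃ c : ThetaH B, c.vec = coneVec B ρ w :=
    ⟨hw, ThetaH.exists_vec_eq hB (two_ne_zero_of_norm h2) hsymm (coneVec_inr_two ρ w)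
      (qform_coneVec h2 hρ0 hρ hw)⟩
  rw [coneMap, dif_pos h]
  exact h.2.choose_spec

theorem continuousOn_coneVec (h2 : ‖(2 : K)‖ = 1) (hρ0 : 0 ≤ ρ) (hρ : ρ < 1) :
    ContinuousOn (coneVec B ρ) (cone B ρ) := by
  have h1 : ContinuousOn (fun w : Idx n → K => ballSqrt ρ (qform B w)) (cone B ρ) :=
    (continuousOn_ballSqrt h2 hρ0 hρ).comp (continuous_qform B).continuousOn fun w hw => hw.2
  have h3 : Continuous fun w : Idx n → K => w - w (Sum.inr 2) • (eMinus : Idx n → K) := by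
    fun_prop
  exact (h1.inv₀ fun w hw => ballSqrt_ne_zero_of_mem_cone h2 hρ0 hρ hw).smul h3.continuousOn

theorem continuousOn_coneMap (hB : B.det ≠ 0) (h2 : ‖(2 : K)‖ = 1)
    (hsymm : B.IsSymm) (hρ0 : 0 ≤ ρ) (hρ : ρ < 1) :
    ContinuousOn (coneMap B ρ) (cone B ρ) := by
  rw [(ThetaH.isEmbedding_vec hB (two_ne_zero_of_norm h2) hsymm).isInducing.continuousOn_iff]
  exact (continuousOn_coneVec h2 hρ0 hρ).congr fun w hw => vec_coneMap hB h2 hsymm hρ0 hρ hw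

theorem coneMap_act (hB : B.det ≠ 0) (h2 : ‖(2 : K)‖ = 1) (hsymm : B.IsSymm)
    (hρ0 : 0 ≤ ρ) (hρ : ρ < 1) (h : groupH B) {w : Idx n → K} (hw : w ∈ cone B ρ) :
    coneMap B ρ (act w (h : groupG B)) = ThetaH.rmul h (coneMap B ρ w) := by
  apply ThetaH.vec_injective
  rw [vec_coneMap hB h2 hsymm hρ0 hρ ((act_mem_cone_iff h w).mpr hw), ThetaH.vec_rmul,
    vec_coneMap hB h2 hsymm hρ0 hρ hw, coneVec_act]

variable [MeasurableSpace K] [BorelSpace K] (da : Measure K) [da.IsAddHaarMeasure]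

theorem measurable_coneMap (hB : B.det ≠ 0) (h2 : ‖(2 : K)‖ = 1)
    (hsymm : B.IsSymm) (hρ0 : 0 ≤ ρ) (hρ : ρ < 1) : Measurable (coneMap B ρ) := by
  classical
  have h1 : ContinuousOn (coneMap B ρ) (cone B ρ)ᶜ := by
    refine (continuousOn_const (c := ThetaH.mk 1)).congr fun w hw => ?_
    rw [coneMap, dif_neg]
    exact fun h => hw h.1
  have h3 := (continuousOn_coneMap hB h2 hsymm hρ0 hρ).measurable_piecewise h1
    (isClosed_cone B ρ).measurableSet
  rwa [Set.piecewise_same] at h3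

/-- The image of additive Haar measure on the cone under the projection to `Θ\H`. -/
def coneMeasure (da : Measure K) (B : Matrix (Fin n) (Fin n) K) (ρ : ℝ) : Measure (ThetaH B) :=
  Measure.map (coneMap B ρ) ((Measure.pi fun _ => da).restrict (cone B ρ))

theorem coneMeasure_apply (hB : B.det ≠ 0) (h2 : ‖(2 : K)‖ = 1) (hsymm : B.IsSymm) (hρ0 : 0 ≤ ρ)
    (hρ : ρ < 1) {S : Set (ThetaH B)} (hS : MeasurableSet S) :
    coneMeasure da B ρ S = (Measure.pi fun _ => da) (coneMap B ρ ⁻¹' S ∩ cone B ρ) := by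
  rw [coneMeasure, Measure.map_apply (measurable_coneMap hB h2 hsymm hρ0 hρ) hS,
    Measure.restrict_apply (measurable_coneMap hB h2 hsymm hρ0 hρ hS)]

/-- $H$ preserves Haar measure and the cone, and the projection is $H$-equivariant. -/
theorem coneMeasure_invariant (hK : NormIsModulus K) (hB : B.det ≠ 0) (h2 : ‖(2 : K)‖ = 1)
    (hsymm : B.IsSymm) (hρ0 : 0 ≤ ρ)
    (hρ : ρ < 1) (h : groupH B) {S : Set (ThetaH B)} (hS : MeasurableSet S) :
    coneMeasure da B ρ (ThetaH.rmul h ⁻¹' S) = coneMeasure da B ρ S := by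
  have hm := measurable_coneMap hB h2 hsymm hρ0 hρ
  rw [coneMeasure_apply da hB h2 hsymm hρ0 hρ hS, coneMeasure_apply da hB h2 hsymm hρ0 hρ
    ((ThetaH.continuous_rmul h).measurable hS)]
  have hpres := hK.measurePreserving_vecMul da
    (((h : groupG B) : GL (Idx n) K) : Matrix (Idx n) (Idx n) K) (norm_det_groupG hB _)
  rw [← hpres.measure_preimage
    ((hm hS).inter (isClosed_cone B ρ).measurableSet).nullMeasurableSet]
  congr 1
  ext w
  change _ ↔ act w (h : groupG B) ∈ coneMap B ρ ⁻¹' S ∩ cone B ρ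
  rw [Set.mem_inter_iff, Set.mem_inter_iff, act_mem_cone_iff]
  refine and_congr_left fun hw => ?_
  rw [Set.mem_preimage, Set.mem_preimage, Set.mem_preimage,
    coneMap_act hB h2 hsymm hρ0 hρ h hw]

theorem isFiniteMeasureOnCompacts_coneMeasure (hB : B.det ≠ 0) (h2 : ‖(2 : K)‖ = 1)
    (hsymm : B.IsSymm) (hρ0 : 0 ≤ ρ) (hρ : ρ < 1) :
    IsFiniteMeasureOnCompacts (coneMeasure da B ρ) := by
  have : T2Space (ThetaH B) :=
    (ThetaH.isEmbedding_vec hB (two_ne_zero_of_norm h2) hsymm).t2Space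
  refine ⟨fun T hT => ?_⟩
  rw [coneMeasure_apply da hB h2 hsymm hρ0 hρ hT.measurableSet]
  obtain ⟨M, hM⟩ := (hT.image ThetaH.continuous_vec).isBounded.exists_norm_le
  refine (measure_mono (t := Metric.closedBall (0 : Idx n → K) (max M 1)) ?_).trans_lt
    (isCompact_closedBall _ _).measure_lt_top
  rintro w ⟨hwT, hw⟩
  rw [mem_closedBall_zero_iff, pi_norm_le_iff_of_nonneg (zero_le_one.trans (le_max_right _ _))]
  have hv : ‖coneVec B ρ w‖ ≤ M :=
    hM _ ⟨_, hwT, vec_coneMap hB h2 hsymm hρ0 hρ hw⟩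
  intro i
  -- The vector $w$ is recovered from its projection, a scalar of norm one and its $e_-$-coordinate.
  -- Since the cone bounds the latter by $1$, the preimage of a compact set is bounded.
  have hi : w i = ballSqrt ρ (qform B w) * coneVec B ρ w i
      + w (Sum.inr 2) * (eMinus : Idx n → K) i := by
    simp only [coneVec, Pi.smul_apply, Pi.sub_apply, smul_eq_mul]
    rw [mul_inv_cancel_left₀ (ballSqrt_ne_zero_of_mem_cone h2 hρ0 hρ hw)]
    ring
  have he : ‖(eMinus : Idx n → K) i‖ ≤ 1 := by
    rcases i with i | i
    · simp [eMinus]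
    · fin_cases i <;> simp [eMinus]
  rw [hi]
  refine (IsUltrametricDist.norm_add_le_max _ _).trans (max_le_max ?_ ?_)
  · rw [norm_mul, norm_ballSqrt h2 hρ0 hρ hw.2, one_mul]
    exact (norm_le_pi_norm _ i).trans hv
  · rw [norm_mul]
    exact mul_le_one₀ hw.1 (norm_nonneg _) he

theorem measurableSet_unitCell (hB : B.det ≠ 0) (h2 : (2 : K) ≠ 0) (hsymm : B.IsSymm) :
    MeasurableSet (unitCell B) := by
  have h : unitCell B = ThetaH.vec ⁻¹' ({v | ‖v (Sum.inr 0)‖ = 1} ∩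
      ⋂ i, {v : Idx n → K | ‖v (Sum.inl i)‖ ≤ 1}) := by
    ext c
    rw [mem_unitCell_iff hB h2 hsymm]
    simp
  rw [h]
  refine (IsClosed.preimage ThetaH.continuous_vec ?_).measurableSet
  exact (isClosed_eq (continuous_apply _).norm continuous_const).inter
    (isClosed_iInter fun i => isClosed_le (continuous_apply _).norm continuous_const)

theorem coneMeasure_unitCell_ne_top (hB : B.det ≠ 0) (h2 : ‖(2 : K)‖ = 1)
    (hsymm : B.IsSymm) (hρ0 : 0 ≤ ρ) (hρ : ρ < 1) : coneMeasure da B ρ (unitCell B) ≠ ∞ := by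
  have := isFiniteMeasureOnCompacts_coneMeasure da hB h2 hsymm hρ0 hρ
  refine ((measure_mono ?_).trans_lt (isCompact_cellUnit.image
    (continuous_cellMap hB (two_ne_zero_of_norm h2) hsymm)).measure_lt_top).ne
  rintro c ⟨h, l, a, hl, ha, hM, rfl⟩
  refine ⟨(l, a), ⟨hl, ha⟩, ?_⟩
  apply congrArg ThetaH.mk
  ext i j
  exact congrFun (congrFun hM.symm i) j

theorem coneMeasure_unitCell_ne_zero (hB : B.det ≠ 0) (h2 : ‖(2 : K)‖ = 1)
    (hsymm : B.IsSymm) (hρ0 : 0 < ρ) (hρ : ρ < 1) : coneMeasure da B ρ (unitCell B) ≠ 0 := by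
  have h20 := two_ne_zero_of_norm h2
  rw [coneMeasure_apply da hB h2 hsymm hρ0.le hρ (measurableSet_unitCell hB h20 hsymm)]
  -- An open neighbourhood of $e_+$ in the cone that projects into the unit cell: dividing by a root
  -- of norm one does not change the norms of the coordinates.
  let O : Set (Idx n → K) := ({w | ‖w (Sum.inr 2)‖ < 1} ∩ {w | ‖qform B w - 1‖ < ρ}) ∩
    ({w | ‖w (Sum.inr 0) - 1‖ < 1} ∩ ⋂ i, {w | ‖w (Sum.inl i)‖ < 1})
  have hO : IsOpen O :=
    ((isOpen_lt (continuous_apply _).norm continuous_const).inter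
      (isOpen_lt ((continuous_qform B).sub continuous_const).norm continuous_const)).inter
    ((isOpen_lt ((continuous_apply _).sub continuous_const).norm continuous_const).inter
      (isOpen_iInter_of_finite fun i => isOpen_lt (continuous_apply _).norm continuous_const))
  have hOne : O.Nonempty := by
    refine ⟨ePlus, ⟨?_, ?_⟩, ?_, ?_⟩
    · simp [ePlus]
    · simpa [qform_ePlus h20] using hρ0
    · simp [ePlus]
    · simp [ePlus]
  refine ((hO.measure_pos _ hOne).trans_le (measure_mono ?_)).ne'
  rintro w ⟨⟨hw2, hwq⟩, hw0, hwl⟩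
  have hw : w ∈ cone B ρ := ⟨le_of_lt hw2, mem_closedBall_iff_norm.mpr (le_of_lt hwq)⟩
  refine ⟨?_, hw⟩
  rw [Set.mem_preimage, mem_unitCell_iff hB h20 hsymm, vec_coneMap hB h2 hsymm hρ0.le hρ hw]
  have hn : ∀ i, (eMinus : Idx n → K) i = 0 → ‖coneVec B ρ w i‖ = ‖w i‖ := by
    intro i hi
    simp [coneVec, hi, norm_ballSqrt h2 hρ0.le hρ hw.2]
  refine ⟨?_, fun i => ?_⟩
  · rw [hn _ (by simp [eMinus])]
    exact norm_eq_one_of_mem_closedBall hw0 (mem_closedBall_iff_norm.mpr le_rfl)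
  · rw [hn _ (by simp [eMinus])]
    exact le_of_lt (Set.mem_iInter.mp hwl i)

theorem exists_isPeriodMeasure (hK : NormIsModulus K) (da : Measure K) [da.IsAddHaarMeasure]
    (hB : B.det ≠ 0) (h2 : ‖(2 : K)‖ = 1)
    (hsymm : B.IsSymm) : ∃ μ : Measure (ThetaH B), IsPeriodMeasure B μ := by
  obtain ⟨ϖ, hϖ0, hϖ1⟩ := NormedField.exists_norm_lt_one K
  have := isFiniteMeasureOnCompacts_coneMeasure da hB h2 hsymm hϖ0.le hϖ1
  have h0 := coneMeasure_unitCell_ne_zero da hB h2 hsymm hϖ0 hϖ1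
  have htop := coneMeasure_unitCell_ne_top da hB h2 hsymm hϖ0.le hϖ1
  refine ⟨(coneMeasure da B ‖ϖ‖ (unitCell B))⁻¹ • coneMeasure da B ‖ϖ‖, ⟨⟨fun T hT => ?_⟩, ?_, ?_⟩⟩
  · rw [Measure.smul_apply, smul_eq_mul]
    exact ENNReal.mul_lt_top (ENNReal.inv_lt_top.mpr (pos_iff_ne_zero.mpr h0)) hT.measure_lt_top
  · intro h S hS
    rw [Measure.smul_apply, Measure.smul_apply,
      coneMeasure_invariant da hK hB h2 hsymm hϖ0.le hϖ1 h hS]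
  · rw [Measure.smul_apply, smul_eq_mul, ENNReal.inv_mul_cancel h0 htop]

end Existence

/-! ### Volumes of sets on which a quadratic form is close to a given value. -/

section VolumeBounds

open scoped Pointwise NNReal ENNReal

variable {K : Type*} [NontriviallyNormedField K] [ProperSpace K] [MeasurableSpace K] [BorelSpace K]
  {n : ℕ}

theorem NormIsModulus.exists_measure_closedBall_le (hK : NormIsModulus K) (da : Measure K)
    [da.IsAddHaarMeasure] (hda : da {x : K | ‖x‖ ≤ 1} = 1) :
    ∃ C : ℝ, 0 ≤ C ∧ ∀ (x : K) (r : ℝ), 0 < r →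
      da (Metric.closedBall x r) ≤ ENNReal.ofReal (C * r) := by
  obtain ⟨c, hc⟩ := NormedField.exists_one_lt_norm K
  have hc0 : c ≠ 0 := norm_pos_iff.mp (one_pos.trans hc)
  -- The radius lies in some $[|c|^k,|c|^{k+1})$, and the ball of radius $|c|^{k+1}\le|c|r$ has
  -- volume exactly $|c|^{k+1}$; hence the constant $|c|$.
  refine ⟨‖c‖, norm_nonneg _, fun x r hr => ?_⟩
  obtain ⟨k, hk1, hk2⟩ := exists_mem_Ico_zpow hr hc
  let u : Kˣ := (Units.mk0 c hc0) ^ (k + 1)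
  have hu : ‖(u : K)‖ = ‖c‖ ^ (k + 1) := by simp [u]
  have hball : Metric.closedBall (0 : K) 1 = {x : K | ‖x‖ ≤ 1} := by ext; simp
  calc da (Metric.closedBall x r) = da (Metric.closedBall 0 r) := by
        rw [← measure_preimage_add da x (Metric.closedBall x r), preimage_add_closedBall, sub_self]
    _ ≤ da (u • Metric.closedBall 0 1) := by
        refine measure_mono ?_
        rw [units_smul_closedBall, mul_one, hu]
        exact Metric.closedBall_subset_closedBall hk2.le
    _ = ENNReal.ofReal ‖(u : K)‖ := by
        rw [← distribHaarChar_mul, hK u, hball, hda, mul_one, ofReal_norm]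
        rfl
    _ ≤ ENNReal.ofReal (‖c‖ * r) := by
        refine ENNReal.ofReal_le_ofReal ?_
        rw [hu, zpow_add_one₀ (norm_ne_zero_iff.mpr hc0), mul_comm]
        exact mul_le_mul_of_nonneg_left hk1 (norm_nonneg _)

theorem measurableSet_quad_near (B : Matrix (Fin n) (Fin n) K) (s : K) (ε : ℝ) :
    MeasurableSet {a : Fin n → K | ‖s - quad B a‖ ≤ ε} :=
  (isClosed_le (continuous_const.sub (continuous_quad B)).norm continuous_const).measurableSet

variable [IsUltrametricDist K]

/-- If $x_0$ lies in the set, subtracting its value from that at $x$ gives $b(x-x_0)(x+x_0+c/b)$, of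
norm at most $\varepsilon$. One of the last two factors then has norm at most
$(\varepsilon/|b|)^{1/2}$, so two balls suffice. No roots are needed, and the bound is uniform in
$c$ and $d$. -/
theorem NormIsModulus.exists_measure_quadratic_le (hK : NormIsModulus K) (da : Measure K)
    [da.IsAddHaarMeasure] (hda : da {x : K | ‖x‖ ≤ 1} = 1) {b : K} (hb : b ≠ 0) :
    ∃ C : ℝ, 0 ≤ C ∧ ∀ (c d : K) (ε : ℝ), 0 < ε →
      da {x | ‖b * x ^ 2 + c * x + d‖ ≤ ε} ≤ ENNReal.ofReal (C * ε ^ (1 / 2 : ℝ)) := by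
  obtain ⟨C, hC, hball⟩ := hK.exists_measure_closedBall_le da hda
  have hb' : 0 < ‖b‖ := norm_pos_iff.mpr hb
  refine ⟨2 * (C * (‖b‖⁻¹) ^ (1 / 2 : ℝ)), by positivity, fun c d ε hε => ?_⟩
  rcases Set.eq_empty_or_nonempty {x | ‖b * x ^ 2 + c * x + d‖ ≤ ε} with h | ⟨x₀, h₀⟩
  · rw [h, measure_empty]
    exact bot_le
  set r : ℝ := (ε / ‖b‖) ^ (1 / 2 : ℝ) with hr
  have hr0 : 0 < r := Real.rpow_pos_of_pos (div_pos hε hb') _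
  have hrr : r * r = ε / ‖b‖ := by
    rw [hr, ← Real.rpow_add (div_pos hε hb')]
    norm_num
  have hsub : {x | ‖b * x ^ 2 + c * x + d‖ ≤ ε}
      ⊆ Metric.closedBall x₀ r ∪ Metric.closedBall (-x₀ - c / b) r := by
    intro x hx
    have hx' : ‖b * x ^ 2 + c * x + d‖ ≤ ε := hx
    have h₀' : ‖b * x₀ ^ 2 + c * x₀ + d‖ ≤ ε := h₀
    have hprod : ‖x - x₀‖ * ‖x - (-x₀ - c / b)‖ ≤ r * r := by
      rw [hrr, le_div_iff₀ hb', ← norm_mul, ← norm_mul]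
      have h1 : (x - x₀) * (x - (-x₀ - c / b)) * b
          = (b * x ^ 2 + c * x + d) + -(b * x₀ ^ 2 + c * x₀ + d) := by
        field_simp
        ring
      rw [h1]
      refine (IsUltrametricDist.norm_add_le_max _ _).trans (max_le hx' ?_)
      rwa [norm_neg]
    by_contra hcon
    simp only [Set.mem_union, mem_closedBall_iff_norm, not_or, not_le] at hcon
    exact absurd hprod (not_le.mpr (mul_lt_mul'' hcon.1 hcon.2 hr0.le hr0.le))
  calc da {x | ‖b * x ^ 2 + c * x + d‖ ≤ ε}
      ≤ da (Metric.closedBall x₀ r) + da (Metric.closedBall (-x₀ - c / b) r) :=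
        (measure_mono hsub).trans (measure_union_le _ _)
    _ ≤ ENNReal.ofReal (C * r) + ENNReal.ofReal (C * r) :=
        add_le_add (hball _ _ hr0) (hball _ _ hr0)
    _ = _ := by
        rw [← ENNReal.ofReal_add (by positivity) (by positivity), hr, div_eq_mul_inv,
          Real.mul_rpow hε.le (inv_nonneg.mpr hb'.le)]
        congr 1
        ring

variable {B : Matrix (Fin n) (Fin n) K}

/-- Polarization at the standard basis vectors recovers $2B_{ij}$. -/
theorem exists_quad_ne_zero {K : Type*} [NontriviallyNormedField K] {B : Matrix (Fin n) (Fin n) K}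
    (hB : B ≠ 0) (h2 : (2 : K) ≠ 0) (hsymm : B.IsSymm) :
    ∃ u : Fin n → K, quad B u ≠ 0 := by
  by_contra! h
  apply hB
  ext i j
  have h1 := quad_add hsymm (Pi.single i 1) (Pi.single j 1)
  rw [h, h, h] at h1
  simpa [h2] using h1

theorem exists_integral_quad_ne_zero (hB : B ≠ 0) (h2 : (2 : K) ≠ 0) (hsymm : B.IsSymm) :
    ∃ u : Fin n → K, quad B u ≠ 0 ∧ ∀ i, ‖u i‖ ≤ 1 := by
  obtain ⟨u, hu⟩ := exists_quad_ne_zero hB h2 hsymm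
  obtain ⟨c, hc⟩ := NormedField.exists_lt_norm K (‖u‖)
  have hc0 : c ≠ 0 := norm_pos_iff.mp ((norm_nonneg u).trans_lt hc)
  refine ⟨c⁻¹ • u, ?_, fun i => ?_⟩
  · rw [quad_smul]
    exact mul_ne_zero (pow_ne_zero _ (inv_ne_zero hc0)) hu
  · rw [Pi.smul_apply, smul_eq_mul, norm_mul, norm_inv, inv_mul_le_iff₀ (norm_pos_iff.mpr hc0),
      mul_one]
    exact (norm_le_pi_norm u i).trans hc.le

/-- The volume of the integral vectors on which the form is close to a given value. -/
theorem NormIsModulus.exists_measure_quad_near_le (hK : NormIsModulus K) (da : Measure K)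
    [da.IsAddHaarMeasure] (hda : da {x : K | ‖x‖ ≤ 1} = 1) (hB : B ≠ 0) (h2 : (2 : K) ≠ 0)
    (hsymm : B.IsSymm) :
    ∃ C : ℝ, 0 ≤ C ∧ ∀ (s : K) (ε : ℝ), 0 < ε →
      (Measure.pi fun _ => da) ({a : Fin n → K | ∀ i, ‖a i‖ ≤ 1} ∩ {a | ‖s - quad B a‖ ≤ ε})
        ≤ ENNReal.ofReal (C * ε ^ (1 / 2 : ℝ)) := by
  obtain ⟨u, hu, hu1⟩ := exists_integral_quad_ne_zero hB h2 hsymm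
  obtain ⟨C, hC, hCb⟩ := hK.exists_measure_quadratic_le da hda hu
  refine ⟨C, hC, fun s ε hε => ?_⟩
  set O : Set (Fin n → K) := {a | ∀ i, ‖a i‖ ≤ 1} with hO
  have hOm : MeasurableSet O := measurableSet_integral_vectors
  set T : Set (Fin n → K) := O ∩ {a | ‖s - quad B a‖ ≤ ε} with hT
  have hTm : MeasurableSet T := hOm.inter (measurableSet_quad_near B s ε)
  set π := (Measure.pi fun _ : Fin n => da)
  set I : Set K := {x : K | ‖x‖ ≤ 1}
  have hshift : Measurable fun p : K × (Fin n → K) => p.2 + p.1 • u := by fun_prop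
  have hm : Measurable fun p : K × (Fin n → K) => T.indicator (1 : (Fin n → K) → ℝ≥0∞)
      (p.2 + p.1 • u) := (measurable_one.indicator hTm).comp hshift
  have hvol : π O = 1 := measure_integral_vectors da hda
  -- Average over the translations $a\mapsto a+xu$ with $x\in\mathfrak o$. For fixed $a$ the
  -- condition becomes quadratic in $x$ with leading coefficient $B(u)\ne0$, and since $u$ is
  -- integral only $a\in\mathfrak o^n$ contribute.
  calc π T = ∫⁻ x in I, π T ∂da := by
        rw [setLIntegral_const, hda, mul_one]
    _ = ∫⁻ x in I, ∫⁻ a, T.indicator (1 : (Fin n → K) → ℝ≥0∞) (a + x • u) ∂π ∂da := by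
        congr 1
        ext x
        rw [lintegral_add_right_eq_self (μ := π) (T.indicator (1 : (Fin n → K) → ℝ≥0∞)) (x • u),
          lintegral_indicator_one hTm]
    _ = ∫⁻ a, ∫⁻ x in I, T.indicator (1 : (Fin n → K) → ℝ≥0∞) (a + x • u) ∂da ∂π :=
        lintegral_lintegral_swap hm.aemeasurable
    _ ≤ ∫⁻ a, O.indicator (fun _ => ENNReal.ofReal (C * ε ^ (1 / 2 : ℝ))) a ∂π := by
        refine lintegral_mono fun a => ?_
        have hIm : MeasurableSet I := measurableSet_le measurable_norm measurable_const
        have hmem : ∀ x ∈ I, a + x • u ∈ O → a ∈ O := by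
          intro x hx ha i
          have h1 : a i = (a + x • u) i + -(x * u i) := by simp
          rw [h1]
          refine (IsUltrametricDist.norm_add_le_max _ _).trans (max_le (ha i) ?_)
          rw [norm_neg, norm_mul]
          exact mul_le_one₀ hx (norm_nonneg _) (hu1 i)
        by_cases ha : a ∈ O
        · rw [Set.indicator_of_mem ha]
          let c : K := 2 * (a ⬝ᵥ (B *ᵥ u))
          let V : Set K := {x | ‖quad B u * x ^ 2 + c * x + (quad B a - s)‖ ≤ ε}
          have hVm : MeasurableSet V :=
            measurableSet_le (by fun_prop) measurable_const
          calc ∫⁻ x in I, T.indicator (1 : (Fin n → K) → ℝ≥0∞) (a + x • u) ∂da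
              ≤ ∫⁻ x, V.indicator (1 : K → ℝ≥0∞) x ∂da := by
                refine (setLIntegral_le_lintegral _ _).trans (lintegral_mono fun x => ?_)
                by_cases hx : a + x • u ∈ T
                · have hxV : x ∈ V := by
                    have h1 : ‖s - quad B (a + x • u)‖ ≤ ε := hx.2
                    rw [← norm_neg] at h1
                    have h3 : -(s - quad B (a + x • u))
                        = quad B u * x ^ 2 + c * x + (quad B a - s) := by
                      rw [quad_add hsymm, quad_smul, Matrix.mulVec_smul, dotProduct_smul,
                        smul_eq_mul]
                      simp only [c]
                      ring
                    rwa [h3] at h1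
                  rw [Set.indicator_of_mem hx, Set.indicator_of_mem hxV]
                  exact le_rfl
                · rw [Set.indicator_of_notMem hx]
                  exact bot_le
            _ = da V := lintegral_indicator_one hVm
            _ ≤ _ := hCb _ _ _ hε
        · rw [setLIntegral_congr_fun (g := fun _ => 0) hIm]
          · simp
          · intro x hx
            exact Set.indicator_of_notMem (fun h => ha (hmem x hx h.1)) _
    _ = ENNReal.ofReal (C * ε ^ (1 / 2 : ℝ)) := by
        rw [lintegral_indicator_const hOm, hvol, mul_one]

/-- A bound that serves all $n$: a positive power of $|\lambda|$ makes the $\lambda$-integral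
converge, and the loss $|t|^{-\delta}$ with $\delta<\sigma$ is affordable in the $t$-integral. Only
$n=0$ incurs this loss. -/
theorem NormIsModulus.exists_measure_quad_sub_sq_le (hK : NormIsModulus K) (da : Measure K)
    [da.IsAddHaarMeasure] (hda : da {x : K | ‖x‖ ≤ 1} = 1) (hB : B.det ≠ 0) (h2 : (2 : K) ≠ 0)
    (hsymm : B.IsSymm) {σ : ℝ} (hσ : 0 < σ) :
    ∃ C ε δ : ℝ, 0 ≤ C ∧ 0 < ε ∧ δ < σ ∧ ∀ t l : Kˣ,
      (Measure.pi fun _ => da)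
        ({a : Fin n → K | ∀ i, ‖a i‖ ≤ 1} ∩ {a | ‖(t : K) ^ 2 - quad B a‖ ≤ ‖(l : K)‖})
        ≤ ENNReal.ofReal (C * ‖(l : K)‖ ^ ε * ‖(t : K)‖ ^ (-δ)) := by
  rcases Nat.eq_zero_or_pos n with rfl | hn
  -- For $n=0$ the set is empty unless $|t|^2\le|\lambda|$, and then
  -- $|t|^{\sigma/2}\le|\lambda|^{\sigma/4}$, so the bound is at least $1$.
  · refine ⟨1, σ / 4, σ / 2, zero_le_one, by positivity, by linarith, fun t l => ?_⟩
    have ht := units_norm_pos t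
    by_cases h : ‖(t : K)‖ ^ 2 ≤ ‖(l : K)‖
    · refine (measure_mono Set.inter_subset_left).trans ?_
      rw [measure_integral_vectors da hda, ← ENNReal.ofReal_one]
      refine ENNReal.ofReal_le_ofReal ?_
      rw [one_mul, Real.rpow_neg ht.le, ← div_eq_mul_inv, one_le_div (by positivity)]
      calc ‖(t : K)‖ ^ (σ / 2) = (‖(t : K)‖ ^ 2) ^ (σ / 4) := by
            rw [← Real.rpow_natCast, ← Real.rpow_mul ht.le]
            congr 1
            push_cast
            ring
        _ ≤ _ := Real.rpow_le_rpow (by positivity) h (by positivity)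
    · have : {a : Fin 0 → K | ‖(t : K) ^ 2 - quad B a‖ ≤ ‖(l : K)‖} = ∅ := by
        ext a
        simpa [quad] using h
      rw [this, Set.inter_empty, measure_empty]
      exact bot_le
  · have hB0 : B ≠ 0 := by
      rintro rfl
      exact hB (have : Nonempty (Fin n) := ⟨⟨0, hn⟩⟩; Matrix.det_zero)
    obtain ⟨C, hC, h⟩ := hK.exists_measure_quad_near_le da hda hB0 h2 hsymm
    refine ⟨C, 1 / 2, 0, hC, by positivity, hσ, fun t l => ?_⟩
    rw [neg_zero, Real.rpow_zero, mul_one]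
    exact h _ _ (units_norm_pos l)

end VolumeBounds

/-! ### Absolute convergence of $\varphi(g)$ and of $\Pi^B$. -/

section Convergence

open scoped NNReal ENNReal

variable {K : Type*} [NontriviallyNormedField K] [ProperSpace K] [MeasurableSpace K] [BorelSpace K]
  {n : ℕ} {B : Matrix (Fin n) (Fin n) K}

theorem enorm_norm_cpow (t : Kˣ) (α : ℂ) :
    ‖((‖(t : K)‖ : ℝ) : ℂ) ^ α‖ₑ = ENNReal.ofReal (‖(t : K)‖ ^ α.re) := by
  rw [← ofReal_norm, Complex.norm_cpow_eq_rpow_re_of_pos (units_norm_pos t)]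

theorem measurable_norm_cpow (α : ℂ) :
    Measurable fun t : Kˣ => ((‖(t : K)‖ : ℝ) : ℂ) ^ α :=
  (Complex.measurable_ofReal.comp measurable_units_norm).pow_const α

theorem measurable_PhiFun : Measurable (PhiFun : (Idx n → K) → ℂ) := by
  unfold PhiFun
  refine measurable_const.indicator ?_
  have h : {v : Idx n → K | ∀ i, ‖v i‖ ≤ 1} = ⋂ i, {v | ‖v i‖ ≤ 1} := by ext; simp
  rw [h]
  exact MeasurableSet.iInter fun i =>
    measurableSet_le (measurable_pi_apply i).norm measurable_const

/-- The vector $e\cdot g$ is nonzero, and integrality of any nonzero coordinate of $te\cdot g$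
confines $t$ to a ball, on which $|t|^{\operatorname{Re}\alpha}$ is integrable. -/
theorem integrable_phi_integrand (dt : Measure Kˣ) [dt.IsHaarMeasure] {α : ℂ} (hα : 0 < α.re)
    (g : groupG B) :
    Integrable (fun t : Kˣ => ((‖(t : K)‖ : ℝ) : ℂ) ^ α * PhiFun ((t : K) • act eVec g)) dt := by
  have hsm : Measurable fun t : Kˣ => (t : K) • act eVec g :=
    measurable_units_val.smul_const _
  refine ⟨((measurable_norm_cpow α).mul (measurable_PhiFun.comp hsm)).aestronglyMeasurable, ?_⟩
  have hne : act eVec g ≠ 0 := by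
    intro h
    have h1 : act (act eVec g) g⁻¹ = eVec := by rw [← act_mul, mul_inv_cancel, act_one]
    rw [h] at h1
    have h3 := congrFun h1 (Sum.inr 2)
    simp [act, eVec, ePlus, eMinus] at h3
  obtain ⟨i, hi⟩ := Function.ne_iff.mp hne
  have hi0 : 0 < ‖act eVec g i‖ := norm_pos_iff.mpr hi
  have hms : MeasurableSet {t : Kˣ | ‖(t : K)‖ ≤ ‖act eVec g i‖⁻¹} :=
    measurableSet_le measurable_units_norm measurable_const
  rw [HasFiniteIntegral]
  refine lt_of_le_of_lt ?_ (lintegral_norm_rpow_ball dt hα ‖act eVec g i‖⁻¹)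
  rw [← lintegral_indicator hms]
  refine lintegral_mono fun t => ?_
  by_cases ht : (t : K) • act eVec g ∈ {v : Idx n → K | ∀ i, ‖v i‖ ≤ 1}
  · have ht' : t ∈ {t : Kˣ | ‖(t : K)‖ ≤ ‖act eVec g i‖⁻¹} := by
      have h1 := ht i
      rw [Pi.smul_apply, smul_eq_mul, norm_mul] at h1
      change ‖(t : K)‖ ≤ _
      rw [← one_div]
      exact (le_div_iff₀ hi0).mpr h1
    rw [Set.indicator_of_mem ht', PhiFun, Set.indicator_of_mem ht, mul_one, enorm_norm_cpow]
  · rw [PhiFun, Set.indicator_of_notMem ht, mul_zero, enorm_zero]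
    exact bot_le

theorem measurable_chFun (B : Matrix (Fin n) (Fin n) K) :
    Measurable fun p : Kˣ × (Fin n → K) × Kˣ => chFun B p.1 p.2.1 p.2.2 := by
  have h1 : MeasurableSet {p : Kˣ × (Fin n → K) × Kˣ |
      ‖(p.1 : K) ^ 2 - quad B p.2.1‖ ≤ ‖(p.2.2 : K)‖ ∧ ‖(p.2.2 : K)‖ ≤ 1} := by
    have h3 : Measurable fun p : Kˣ × (Fin n → K) × Kˣ => ‖(p.2.2 : K)‖ :=
      measurable_units_norm.comp (measurable_snd.comp measurable_snd)
    refine (measurableSet_le ?_ h3).inter (measurableSet_le h3 measurable_const)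
    exact (((measurable_units_val.comp measurable_fst).pow_const 2).sub
      ((measurable_quad B).comp (measurable_fst.comp measurable_snd))).norm
  exact (measurable_const (a := (1 : ℂ))).indicator h1

theorem measurable_Pi_integrand (B : Matrix (Fin n) (Fin n) K) (α β : ℂ) :
    Measurable fun p : Kˣ × (Fin n → K) × Kˣ => ((‖(p.1 : K)‖ : ℝ) : ℂ) ^ α *
        (((‖(p.2.2 : K)‖ : ℝ) : ℂ) ^ β * chFun B p.1 p.2.1 p.2.2) :=
  ((measurable_norm_cpow α).comp measurable_fst).mul
    (((measurable_norm_cpow β).comp (measurable_snd.comp measurable_snd)).mul (measurable_chFun B))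

theorem measurableSet_units_unit_ball : MeasurableSet {t : Kˣ | ‖(t : K)‖ ≤ 1} :=
  measurableSet_le measurable_units_norm measurable_const

variable (da : Measure K) [da.IsAddHaarMeasure] (dt : Measure Kˣ) [dt.IsHaarMeasure]

theorem restrict_prod_integral :
    (dt.prod ((Measure.pi fun _ => da).prod dt)).restrict
      {p : Kˣ × (Fin n → K) × Kˣ | ‖(p.1 : K)‖ ≤ 1 ∧ ∀ i, ‖p.2.1 i‖ ≤ 1}
    = (dt.restrict {t : Kˣ | ‖(t : K)‖ ≤ 1}).prod
      (((Measure.pi fun _ => da).restrict {a : Fin n → K | ∀ i, ‖a i‖ ≤ 1}).prod dt) := by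
  have h : {p : Kˣ × (Fin n → K) × Kˣ | ‖(p.1 : K)‖ ≤ 1 ∧ ∀ i, ‖p.2.1 i‖ ≤ 1}
      = {t : Kˣ | ‖(t : K)‖ ≤ 1} ×ˢ ({a : Fin n → K | ∀ i, ‖a i‖ ≤ 1} ×ˢ Set.univ) := by
    ext p
    simp
  conv_rhs => rw [← Measure.restrict_univ (μ := dt)]
  rw [Measure.prod_restrict, Measure.restrict_univ, Measure.prod_restrict, h]

theorem enorm_Pi_integrand (B : Matrix (Fin n) (Fin n) K) (α : ℂ) (t l : Kˣ) (a : Fin n → K) :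
    ‖((‖(t : K)‖ : ℝ) : ℂ) ^ α * (((‖(l : K)‖ : ℝ) : ℂ) ^ (0 : ℂ) * chFun B t a l)‖ₑ
      = ENNReal.ofReal (‖(t : K)‖ ^ α.re) * {l : Kˣ | ‖(l : K)‖ ≤ 1}.indicator (fun l =>
          {a | ‖(t : K) ^ 2 - quad B a‖ ≤ ‖(l : K)‖}.indicator (1 : (Fin n → K) → ℝ≥0∞) a) l := by
  rw [Complex.cpow_zero, one_mul, enorm_mul, enorm_norm_cpow]
  congr 1
  by_cases hl : ‖(l : K)‖ ≤ 1
  · rw [Set.indicator_of_mem (by exact hl)]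
    by_cases ha : ‖(t : K) ^ 2 - quad B a‖ ≤ ‖(l : K)‖
    · rw [chFun, Set.indicator_of_mem (by exact ⟨ha, hl⟩), Set.indicator_of_mem (by exact ha)]
      simp
    · rw [chFun, Set.indicator_of_notMem (by exact fun h => ha h.1),
        Set.indicator_of_notMem (by exact ha), enorm_zero]
  · rw [chFun, Set.indicator_of_notMem (by exact fun h => hl h.2),
      Set.indicator_of_notMem (by exact hl), enorm_zero]

/-- With $t$ fixed, integrating over $a$ before $\lambda$ lets the volume bound supply the power
$|\lambda|^\varepsilon$ that $\beta=0$ lacks. -/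
theorem lintegral_enorm_Pi_integrand_le (α : ℂ) (t : Kˣ)
    {C ε δ : ℝ} (hC : 0 ≤ C)
    (hvol : ∀ l : Kˣ, (Measure.pi fun _ => da)
        ({a : Fin n → K | ∀ i, ‖a i‖ ≤ 1} ∩ {a | ‖(t : K) ^ 2 - quad B a‖ ≤ ‖(l : K)‖})
        ≤ ENNReal.ofReal (C * ‖(l : K)‖ ^ ε * ‖(t : K)‖ ^ (-δ))) :
    ∫⁻ q : (Fin n → K) × Kˣ, ‖((‖(t : K)‖ : ℝ) : ℂ) ^ α *
        (((‖(q.2 : K)‖ : ℝ) : ℂ) ^ (0 : ℂ) * chFun B t q.1 q.2)‖ₑ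
        ∂(((Measure.pi fun _ => da).restrict {a : Fin n → K | ∀ i, ‖a i‖ ≤ 1}).prod dt)
      ≤ ENNReal.ofReal (‖(t : K)‖ ^ (α.re - δ)) * (ENNReal.ofReal C *
        ∫⁻ l in {l : Kˣ | ‖(l : K)‖ ≤ 1}, ENNReal.ofReal (‖(l : K)‖ ^ ε) ∂dt) := by
  have ht := units_norm_pos t
  have hm : Measurable fun q : (Fin n → K) × Kˣ => ‖((‖(t : K)‖ : ℝ) : ℂ) ^ α *
      (((‖(q.2 : K)‖ : ℝ) : ℂ) ^ (0 : ℂ) * chFun B t q.1 q.2)‖ₑ := by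
    have h := (measurable_Pi_integrand B α 0).comp
      (measurable_prodMk_left (x := t) (β := (Fin n → K) × Kˣ))
    exact h.enorm
  rw [lintegral_prod_symm _ hm.aemeasurable, ← lintegral_const_mul _
    (measurable_units_norm.pow_const ε).ennreal_ofReal, ← lintegral_const_mul _
    ((measurable_units_norm.pow_const ε).ennreal_ofReal.const_mul _),
    ← lintegral_indicator measurableSet_units_unit_ball]
  refine lintegral_mono fun l => ?_
  simp only [enorm_Pi_integrand]
  by_cases hl : ‖(l : K)‖ ≤ 1
  · simp only [Set.indicator_of_mem (show l ∈ {l : Kˣ | ‖(l : K)‖ ≤ 1} from hl)]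
    have hQ := measurableSet_quad_near B ((t : K) ^ 2) ‖(l : K)‖
    rw [lintegral_const_mul _ (measurable_one.indicator hQ), lintegral_indicator_one hQ,
      Measure.restrict_apply hQ, Set.inter_comm]
    calc _ ≤ ENNReal.ofReal (‖(t : K)‖ ^ α.re) *
          ENNReal.ofReal (C * ‖(l : K)‖ ^ ε * ‖(t : K)‖ ^ (-δ)) := by
          gcongr
          exact hvol l
      _ = _ := by
          rw [← ENNReal.ofReal_mul (by positivity), ← ENNReal.ofReal_mul hC,
            ← ENNReal.ofReal_mul (by positivity), sub_eq_add_neg, Real.rpow_add ht]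
          congr 1
          ring
  · simp only [Set.indicator_of_notMem (show l ∉ {l : Kˣ | ‖(l : K)‖ ≤ 1} from hl)]
    simp

theorem piConverges [IsUltrametricDist K] (hK : NormIsModulus K)
    (hda : da {x : K | ‖x‖ ≤ 1} = 1) (hB : B.det ≠ 0) (h2 : (2 : K) ≠ 0)
    (hsymm : B.IsSymm) {α : ℂ} (hα : 0 < α.re) : PiConverges da dt B α 0 := by
  have hmeas := measurable_Pi_integrand B α 0
  refine ⟨hmeas.aestronglyMeasurable, ?_⟩
  rw [HasFiniteIntegral, restrict_prod_integral, lintegral_prod _ hmeas.enorm.aemeasurable]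
  obtain ⟨C, ε, δ, hC, hε, hδ, hvol⟩ := hK.exists_measure_quad_sub_sq_le da hda hB h2 hsymm hα
  refine (lintegral_mono fun t =>
    lintegral_enorm_Pi_integrand_le da dt α t hC (hvol t)).trans_lt ?_
  rw [lintegral_mul_const _ (measurable_units_norm.pow_const _).ennreal_ofReal]
  exact ENNReal.mul_lt_top (lintegral_norm_rpow_unit_ball dt (by linarith))
    (ENNReal.mul_lt_top ENNReal.ofReal_lt_top (lintegral_norm_rpow_unit_ball dt hε))

end Convergence

/-! ### The substitution and the evaluation of the period. -/

section Period

open scoped NNReal ENNReal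

variable {K : Type*} [NontriviallyNormedField K] [ProperSpace K] [MeasurableSpace K] [BorelSpace K]
  {n : ℕ} {B : Matrix (Fin n) (Fin n) K}

/-- The substitution `(t, λ, a) ↦ (t, tλa, tλ)`. -/
def substMap (p : Kˣ × Kˣ × (Fin n → K)) : Kˣ × (Fin n → K) × Kˣ :=
  (p.1, ((p.1 * p.2.1 : Kˣ) : K) • p.2.2, p.1 * p.2.1)

theorem measurable_substMap :
    Measurable (substMap : Kˣ × Kˣ × (Fin n → K) → Kˣ × (Fin n → K) × Kˣ) := by
  have h1 : Measurable fun p : Kˣ × Kˣ × (Fin n → K) => p.1 * p.2.1 :=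
    measurable_fst.mul (measurable_fst.comp measurable_snd)
  exact measurable_fst.prodMk (((measurable_units_val.comp h1).smul
    (measurable_snd.comp measurable_snd)).prodMk h1)

variable (da : Measure K) [da.IsAddHaarMeasure] (dt : Measure Kˣ) [dt.IsHaarMeasure]

/-- Dilating $a$ by $t\lambda$ contributes $|t\lambda|^{-n}$, and the density $|\lambda|^n$ cancels
all of it but $|t|^{-n}$; the change $\lambda\mapsto t\lambda$ costs nothing. -/
theorem lintegral_cellMeasure_subst (hK : NormIsModulus K) (t : Kˣ)
    {g : (Fin n → K) × Kˣ → ℝ≥0∞} (hg : Measurable g) :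
    ∫⁻ p, g (((t * p.1 : Kˣ) : K) • p.2, t * p.1) ∂(cellMeasure da dt n)
      = ((‖(t : K)‖₊ ^ n)⁻¹ : ℝ≥0) * ∫⁻ q, g q ∂((Measure.pi fun _ => da).prod dt) := by
  set π := (Measure.pi fun _ : Fin n => da)
  have hdens : Measurable fun l : Kˣ => (‖(l : K)‖₊ : ℝ≥0∞) ^ n :=
    measurable_units_val.nnnorm.coe_nnreal_ennreal.pow_const n
  have h1 : Measurable fun p : Kˣ × (Fin n → K) => t * p.1 := measurable_fst.const_mul t
  have hG : Measurable fun p : Kˣ × (Fin n → K) => g (((t * p.1 : Kˣ) : K) • p.2, t * p.1) :=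
    hg.comp (((measurable_units_val.comp h1).smul measurable_snd).prodMk h1)
  have hgl : Measurable fun l : Kˣ => ∫⁻ a, g (a, l) ∂π := hg.lintegral_prod_left'
  rw [cellMeasure, lintegral_prod _ hG.aemeasurable,
    lintegral_withDensity_eq_lintegral_mul _ hdens hG.lintegral_prod_right',
    lintegral_prod_symm _ hg.aemeasurable,
    ← lintegral_mul_left_eq_self (fun l => ∫⁻ a, g (a, l) ∂π) t,
    ← lintegral_const_mul _ (show Measurable fun l => ∫⁻ a, g (a, t * l) ∂π from
      hgl.comp (measurable_const_mul t))]
  congr 1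
  ext l
  have hl : ‖(l : K)‖₊ ≠ 0 := by simp
  have h3 : ∫⁻ a, g (((t * l : Kˣ) : K) • a, t * l) ∂π
      = ((‖((t * l : Kˣ) : K)‖₊ ^ n)⁻¹ : ℝ≥0) * ∫⁻ a, g (a, t * l) ∂π := by
    have h4 := lintegral_map (μ := π) (f := fun a => g (a, t * l))
      (g := fun a : Fin n → K => ((t * l : Kˣ) : K) • a) (hg.comp measurable_prodMk_right)
      (by fun_prop)
    rw [← h4, hK.map_units_smul_pi, Fintype.card_fin, lintegral_smul_measure]
    rfl
  rw [Pi.mul_apply, h3, ← mul_assoc, ← ENNReal.coe_pow, ← ENNReal.coe_mul]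
  congr 2
  rw [Units.val_mul, nnnorm_mul, mul_pow, mul_inv, mul_left_comm, mul_inv_cancel₀
    (pow_ne_zero _ hl), mul_one]

theorem measurable_substDensity :
    Measurable fun q : Kˣ × (Fin n → K) × Kˣ => (‖(q.1 : K)‖₊ ^ n)⁻¹ :=
  ((measurable_units_val.comp measurable_fst).nnnorm.pow_const n).inv

theorem measurePreserving_substMap (hK : NormIsModulus K) :
    MeasurePreserving (substMap : Kˣ × Kˣ × (Fin n → K) → _) (dt.prod (cellMeasure da dt n))
      ((dt.prod ((Measure.pi fun _ => da).prod dt)).withDensity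
        fun q => ((‖(q.1 : K)‖₊ ^ n)⁻¹ : ℝ≥0)) := by
  have hsf : SFinite (cellMeasure da dt n) := by unfold cellMeasure; infer_instance
  refine ⟨measurable_substMap, ?_⟩
  have hd : Measurable fun q : Kˣ × (Fin n → K) × Kˣ =>
      (((‖(q.1 : K)‖₊ ^ n)⁻¹ : ℝ≥0) : ℝ≥0∞) :=
    measurable_substDensity.coe_nnreal_ennreal
  ext E hE
  have hf : Measurable (E.indicator (1 : Kˣ × (Fin n → K) × Kˣ → ℝ≥0∞)) :=
    measurable_one.indicator hE
  rw [← lintegral_indicator_one hE, ← lintegral_indicator_one hE,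
    lintegral_map hf measurable_substMap,
    lintegral_withDensity_eq_lintegral_mul _ hd hf,
    lintegral_prod (fun z => E.indicator (1 : Kˣ × (Fin n → K) × Kˣ → ℝ≥0∞) (substMap z))
      (hf.comp measurable_substMap).aemeasurable,
    lintegral_prod _ (hd.mul hf).aemeasurable]
  congr 1
  ext t
  have hft : Measurable fun q : (Fin n → K) × Kˣ => E.indicator (1 : Kˣ × (Fin n → K) × Kˣ → ℝ≥0∞) (t, q) :=
    hf.comp measurable_prodMk_left
  have h1 := lintegral_cellMeasure_subst da dt hK t hft
  simp only [Pi.mul_apply]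
  rw [lintegral_const_mul _ hft, ← h1]
  rfl

/-- The integrand of the period in the coordinates `(t, a, λ)`. -/
def periodIntegrand (B : Matrix (Fin n) (Fin n) K) (α : ℂ) (q : Kˣ × (Fin n → K) × Kˣ) : ℂ :=
  {p : Kˣ × (Fin n → K) × Kˣ | ‖(p.1 : K)‖ ≤ 1 ∧ ∀ i, ‖p.2.1 i‖ ≤ 1}.indicator
    (fun p => ((‖(p.1 : K)‖ : ℝ) : ℂ) ^ α * chFun B p.1 p.2.1 p.2.2) q

theorem measurableSet_integral_region :
    MeasurableSet {p : Kˣ × (Fin n → K) × Kˣ | ‖(p.1 : K)‖ ≤ 1 ∧ ∀ i, ‖p.2.1 i‖ ≤ 1} :=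
  (measurable_fst measurableSet_units_unit_ball).inter
    ((measurable_fst.comp measurable_snd) measurableSet_integral_vectors)

/-- If $c$ is the $x$-coordinate of $te\cdot m_\lambda n_a$, then $t^2-B(t\lambda
a)=2\,t\lambda\,c$. As $|2|=1$, the condition $|c|\le1$ is the lower bound on $|t\lambda|$ in
`chFun`. -/
theorem smul_act_eVec_integral_iff (hB : B.det ≠ 0) (h2 : ‖(2 : K)‖ = 1) (hsymm : B.IsSymm)
    (t : Kˣ) (p : Kˣ × (Fin n → K)) :
    (∀ i, ‖((t : K) • act eVec (cellElt hB (two_ne_zero_of_norm h2) hsymm p : groupG B)) i‖ ≤ 1) ↔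
      (‖(t : K)‖ ≤ 1 ∧ ∀ i, ‖(((t * p.1 : Kˣ) : K) • p.2) i‖ ≤ 1) ∧
      ‖(t : K) ^ 2 - quad B (((t * p.1 : Kˣ) : K) • p.2)‖ ≤ ‖((t * p.1 : Kˣ) : K)‖ ∧
      ‖((t * p.1 : Kˣ) : K)‖ ≤ 1 := by
  have h20 := two_ne_zero_of_norm h2
  have hvec : act eVec (cellElt hB h20 hsymm p : groupG B) = cellVec B p + eMinus := by
    have h1 : act eMinus (cellElt hB h20 hsymm p : groupG B) = eMinus := (cellElt hB h20 hsymm p).2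
    have h3 := act_ePlus_cellElt hB h20 hsymm p
    simp only [act] at h1 h3
    rw [eVec, act, Matrix.add_vecMul, h1, h3]
  rw [hvec]
  have hl := p.1.ne_zero
  have ht := t.ne_zero
  set c : K := (t : K) * (2⁻¹ * (p.1 : K)⁻¹ - (p.1 : K) * (2⁻¹ * quad B p.2))
  have hc : (t : K) ^ 2 - quad B (((t * p.1 : Kˣ) : K) • p.2) = 2 * (((t * p.1 : Kˣ) : K)) * c := by
    rw [quad_smul, Units.val_mul]
    simp only [c]
    field_simp
  have hpos : 0 < ‖((t * p.1 : Kˣ) : K)‖ := units_norm_pos _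
  rw [hc, norm_mul, norm_mul, h2, one_mul, mul_le_iff_le_one_right hpos, Sum.forall]
  simp only [Fin.forall_fin_succ, Pi.smul_apply, Pi.add_apply, cellVec,
    eMinus, Sum.elim_inl, Sum.elim_inr, smul_eq_mul, Units.val_mul]
  simp only [Matrix.cons_val, Fin.succ_zero_eq_one, Fin.succ_one_eq_two, Pi.zero_apply, add_zero,
    zero_add, mul_one, ← mul_assoc]
  simp only [c, ← mul_assoc]
  simp
  tauto

theorem phi_integrand_eq (hB : B.det ≠ 0) (h2 : ‖(2 : K)‖ = 1) (hsymm : B.IsSymm) (α : ℂ)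
    (t : Kˣ) (p : Kˣ × (Fin n → K)) :
    ((‖(t : K)‖ : ℝ) : ℂ) ^ α *
      PhiFun ((t : K) • act eVec (cellElt hB (two_ne_zero_of_norm h2) hsymm p : groupG B))
      = periodIntegrand B α (substMap (t, p)) := by
  have hiff := smul_act_eVec_integral_iff hB h2 hsymm t p
  by_cases h : ∀ i, ‖((t : K) •
      act eVec (cellElt hB (two_ne_zero_of_norm h2) hsymm p : groupG B)) i‖ ≤ 1
  · obtain ⟨h1, h3⟩ := hiff.mp h
    rw [PhiFun, Set.indicator_of_mem (by exact h), periodIntegrand,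
      Set.indicator_of_mem (by exact h1), chFun, Set.indicator_of_mem (by exact h3)]
    rfl
  · rw [PhiFun, Set.indicator_of_notMem (by exact h), mul_zero, periodIntegrand]
    by_cases h1 : ‖(t : K)‖ ≤ 1 ∧ ∀ i, ‖(((t * p.1 : Kˣ) : K) • p.2) i‖ ≤ 1
    · rw [Set.indicator_of_mem (by exact h1), chFun, Set.indicator_of_notMem, mul_zero]
      exact fun h3 => h (hiff.mpr ⟨h1, h3⟩)
    · rw [Set.indicator_of_notMem (by exact h1)]

theorem density_smul_periodIntegrand (B : Matrix (Fin n) (Fin n) K) (α : ℂ) :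
    (fun q : Kˣ × (Fin n → K) × Kˣ =>
      ((‖(q.1 : K)‖₊ ^ n)⁻¹ : ℝ≥0) • periodIntegrand B α q)
    = {p : Kˣ × (Fin n → K) × Kˣ | ‖(p.1 : K)‖ ≤ 1 ∧ ∀ i, ‖p.2.1 i‖ ≤ 1}.indicator
      fun p => ((‖(p.1 : K)‖ : ℝ) : ℂ) ^ (α - n) *
        (((‖(p.2.2 : K)‖ : ℝ) : ℂ) ^ (0 : ℂ) * chFun B p.1 p.2.1 p.2.2) := by
  ext q
  by_cases hq : ‖(q.1 : K)‖ ≤ 1 ∧ ∀ i, ‖q.2.1 i‖ ≤ 1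
  · have hp : ((‖(q.1 : K)‖ : ℝ) : ℂ) ≠ 0 := by
      exact_mod_cast (units_norm_pos q.1).ne'
    rw [periodIntegrand, Set.indicator_of_mem (by exact hq), Set.indicator_of_mem (by exact hq),
      Complex.cpow_zero, one_mul, Complex.cpow_sub _ _ hp, Complex.cpow_natCast, NNReal.smul_def,
      Complex.real_smul]
    push_cast
    ring
  · rw [periodIntegrand, Set.indicator_of_notMem (by exact hq),
      Set.indicator_of_notMem (by exact hq), smul_zero]

/-- `φ` at a point of `Θ\H` in terms of the vector representing it. -/
theorem phiQuot_eq (α : ℂ) (c : ThetaH B) :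
    phiQuot dt B α c
      = ∫ t : Kˣ, ((‖(t : K)‖ : ℝ) : ℂ) ^ α * PhiFun ((t : K) • (c.vec + eMinus)) ∂dt := by
  obtain ⟨h, rfl⟩ := c.exists_mk
  have h1 : act eMinus (h : groupG B) = eMinus := h.2
  have h3 : act eVec (h : groupG B) = (ThetaH.mk h).vec + eMinus := by
    rw [ThetaH.vec_mk]
    simp only [act] at h1 ⊢
    rw [eVec, Matrix.add_vecMul, h1]
  rw [← h3]
  rfl

/-- Through `phiQuot_eq` the integrand is jointly measurable in the coset and $t$. This is needed to
transport integrals along `cellMap`. -/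
theorem stronglyMeasurable_phiQuot (α : ℂ) : StronglyMeasurable (phiQuot dt B α) := by
  have hv : Measurable fun p : ThetaH B × Kˣ => (p.2 : K) • (p.1.vec + eMinus) :=
    (measurable_units_val.comp measurable_snd).smul
      ((ThetaH.continuous_vec.measurable.comp measurable_fst).add_const _)
  have hm : Measurable fun p : ThetaH B × Kˣ =>
      ((‖(p.2 : K)‖ : ℝ) : ℂ) ^ α * PhiFun ((p.2 : K) • (p.1.vec + eMinus)) :=
    ((measurable_norm_cpow α).comp measurable_snd).mul (measurable_PhiFun.comp hv)
  rw [funext (phiQuot_eq (B := B) dt α)]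
  exact StronglyMeasurable.integral_prod_right (f := fun (c : ThetaH B) (t : Kˣ) =>
    ((‖(t : K)‖ : ℝ) : ℂ) ^ α * PhiFun ((t : K) • (c.vec + eMinus))) hm.stronglyMeasurable

theorem integrable_periodIntegrand_of_piConverges {α : ℂ}
    (hPi : PiConverges da dt B (α - n) 0) :
    Integrable (periodIntegrand B α) ((dt.prod ((Measure.pi fun _ => da).prod dt)).withDensity
        fun q => ((‖(q.1 : K)‖₊ ^ n)⁻¹ : ℝ≥0)) := by
  rw [integrable_withDensity_iff_integrable_smul measurable_substDensity]
  change Integrable (fun q : Kˣ × (Fin n → K) × Kˣ =>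
      ((‖(q.1 : K)‖₊ ^ n)⁻¹ : ℝ≥0) • periodIntegrand B α q) _
  rw [density_smul_periodIntegrand, integrable_indicator_iff measurableSet_integral_region]
  exact hPi

theorem integral_periodIntegrand {α : ℂ} (hPi : PiConverges da dt B (α - n) 0) :
    ∫ q, periodIntegrand B α q ∂((dt.prod ((Measure.pi fun _ => da).prod dt)).withDensity
        fun q => ((‖(q.1 : K)‖₊ ^ n)⁻¹ : ℝ≥0)) = PiFun da dt B (α - n) 0 := by
  rw [integral_withDensity_eq_integral_smul measurable_substDensity]
  change ∫ q : Kˣ × (Fin n → K) × Kˣ,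
      ((‖(q.1 : K)‖₊ ^ n)⁻¹ : ℝ≥0) • periodIntegrand B α q ∂_ = _
  rw [density_smul_periodIntegrand, integral_indicator measurableSet_integral_region]
  rw [PiConverges, IntegrableOn, restrict_prod_integral] at hPi
  rw [restrict_prod_integral, integral_prod _ hPi, PiFun]
  refine integral_congr_ae ?_
  filter_upwards [hPi.prod_right_ae] with t ht
  rw [integral_prod _ ht]
  simp only [integral_const_mul]

variable [IsUltrametricDist K]

/-- In cell coordinates the period is an iterated integral over $(\lambda,a)$ and then $t$ inside.
Convergence of $\Pi^B$, pulled back along `substMap`, makes the joint integrand integrable; Fubini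
then gives both integrability of $\varphi$ and the value. -/
theorem IsPeriodMeasure.integral_phiQuot (hK : NormIsModulus K)
    (hda : da {x : K | ‖x‖ ≤ 1} = 1) (hdt : dt {t : Kˣ | ‖(t : K)‖ = 1} = 1) (hB : B.det ≠ 0)
    (h2 : ‖(2 : K)‖ = 1) (hsymm : B.IsSymm) {α : ℂ} (hPi : PiConverges da dt B (α - n) 0)
    {μ : Measure (ThetaH B)} (hμ : IsPeriodMeasure B μ) :
    Integrable (phiQuot dt B α) μ ∧ ∫ c, phiQuot dt B α c ∂μ = PiFun da dt B (α - n) 0 := by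
  have h20 := two_ne_zero_of_norm h2
  have hsf : SFinite (cellMeasure da dt n) := by unfold cellMeasure; infer_instance
  have hpres := measurePreserving_substMap (n := n) da dt hK
  have hint := integrable_periodIntegrand_of_piConverges da dt hPi
  have hcomp : Integrable (fun p => periodIntegrand B α (substMap p))
      (dt.prod (cellMeasure da dt n)) := hpres.integrable_comp_of_integrable hint
  have hval : ∫ p, periodIntegrand B α (substMap p) ∂(dt.prod (cellMeasure da dt n))
      = PiFun da dt B (α - n) 0 := by
    rw [← integral_periodIntegrand da dt hPi, ← hpres.map_eq,
      integral_map measurable_substMap.aemeasurable]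
    rw [hpres.map_eq]
    exact hint.aestronglyMeasurable
  have hphi : ∀ p, phiQuot dt B α (cellMap hB h20 hsymm p)
      = ∫ t, periodIntegrand B α (substMap (t, p)) ∂dt := by
    intro p
    change phi dt B α (cellElt hB h20 hsymm p : groupG B) = _
    rw [phi]
    congr 1
    ext t
    exact phi_integrand_eq hB h2 hsymm α t p
  have hcm := (measurable_cellMap hB h20 hsymm).aemeasurable (μ := cellMeasure da dt n)
  rw [hμ.eq_map hK da hda dt hdt hB h20 hsymm,
    integrable_map_measure (stronglyMeasurable_phiQuot dt α).aestronglyMeasurable hcm,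
    integral_map hcm (stronglyMeasurable_phiQuot dt α).aestronglyMeasurable]
  constructor
  · refine hcomp.integral_prod_right.congr (Filter.Eventually.of_forall fun p => ?_)
    exact (hphi p).symm
  · simp only [hphi]
    rw [← hval, integral_prod_symm _ hcomp]

end Period

end LocalPeriod

end

/-! ### The proposition. -/

theorem propositionp
    {K : Type*} [NontriviallyNormedField K] [IsUltrametricDist K] [ProperSpace K]
    [MeasurableSpace K] [BorelSpace K]
    -- the absolute value of the local field `K` is the normalized one, and `2` is a unit
    (hnorm : ∀ ϖ : (NormedField.valuation (K := K)).integer, Irreducible ϖ →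
      ‖(ϖ : K)‖ =
        (Nat.card (IsLocalRing.ResidueField (NormedField.valuation (K := K)).integer) : ℝ)⁻¹)
    (h2 : ‖(2 : K)‖ = 1)
    -- the additive Haar measure giving the ring of integers mass one
    (da : MeasureTheory.Measure K) [da.IsAddHaarMeasure] (hda : da {x : K | ‖x‖ ≤ 1} = 1)
    -- the multiplicative Haar measure giving the units of the ring of integers mass one
    (dt : MeasureTheory.Measure Kˣ) [dt.IsHaarMeasure] (hdt : dt {t : Kˣ | ‖(t : K)‖ = 1} = 1)
    -- an integral quadratic form with unit discriminant
    (n : ℕ) (B : Matrix (Fin n) (Fin n) K) (hBsymm : B.IsSymm)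
    (hBint : ∀ i j, ‖B i j‖ ≤ 1) (hBdisc : ‖B.det‖ = 1)
    -- the parameters, in the range of absolute convergence
    (s α : ℂ) (hα : α = ((n : ℂ) + 1) * s) (hconv : (n : ℝ) < α.re) :
    (∃! μ : MeasureTheory.Measure (LocalPeriod.ThetaH B), LocalPeriod.IsPeriodMeasure B μ) ∧
    (∀ g : LocalPeriod.groupG B, MeasureTheory.Integrable
      (fun t : Kˣ => ((‖(t : K)‖ : ℝ) : ℂ) ^ α *
        LocalPeriod.PhiFun ((t : K) • LocalPeriod.act LocalPeriod.eVec g)) dt) ∧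
    LocalPeriod.PiConverges da dt B (α - n) 0 ∧
    ∀ μ : MeasureTheory.Measure (LocalPeriod.ThetaH B), LocalPeriod.IsPeriodMeasure B μ →
      MeasureTheory.Integrable (LocalPeriod.phiQuot dt B α) μ ∧
      ∫ c, LocalPeriod.phiQuot dt B α c ∂μ = LocalPeriod.PiFun da dt B (α - n) 0 ∧
      LocalPeriod.PiFun da dt B (α - n) 0
        = LocalPeriod.PiFun da dt B (((n : ℂ) + 1) * (s - 1) + 1) 0 := by
  have hK : LocalPeriod.NormIsModulus K := LocalPeriod.normIsModulus_of_uniformizer hnorm da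
  have hB : B.det ≠ 0 := by
    rw [← norm_ne_zero_iff, hBdisc]
    exact one_ne_zero
  have h20 : (2 : K) ≠ 0 := LocalPeriod.two_ne_zero_of_norm h2
  have hσ : 0 < (α - n).re := by simpa using hconv
  have hα0 : 0 < α.re := (Nat.cast_nonneg n).trans_lt hconv
  have hPi := LocalPeriod.piConverges da dt hK hda hB h20 hBsymm hσ
  refine ⟨?_, LocalPeriod.integrable_phi_integrand dt hα0, hPi, fun μ hμ => ?_⟩
  · obtain ⟨μ, hμ⟩ := LocalPeriod.exists_isPeriodMeasure hK da hB h2 hBsymm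
    -- Both measures equal the same explicit image of `cellMeasure`.
    refine ⟨μ, hμ, fun ν hν => ?_⟩
    rw [hν.eq_map hK da hda dt hdt hB h20 hBsymm, ← hμ.eq_map hK da hda dt hdt hB h20 hBsymm]
  · obtain ⟨h3, h4⟩ := hμ.integral_phiQuot da dt hK hda hdt hB h2 hBsymm hPi
    refine ⟨h3, h4, ?_⟩
    have h5 : α - n = ((n : ℂ) + 1) * (s - 1) + 1 := by
      rw [hα]
      ring
    rw [h5]
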